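/- Let $\mathcal O\subset\mathbb R^d$ be a bounded domain (nonempty, open, connected). For $x\in\mathbb R^d$ let $$\nu(x)=\{\nu\in\mathbb S^{d-1}:\exists C>0\ \forall x'\in\bar{\mathcal O}\ \ (x'-x)\cdot\nu+C|x-x'|^2\ge 0\}.$$ Assume that $\mathcal O$ is admissible, that is: 1. $\nu(x)\ne\emptyset$ for all $x\in\partial\mathcal O$, and there is $C_0\ge 0$ with $(x'-x)\cdot\nu+C_0|x-x'|^2\ge 0$ for all $x'\in\mathcal O$, $x\in\partial\mathcal O$, $\nu\in\nu(x)$; 2. there are $\phi\in C^2(\mathbb R^d;\mathbb R)$ and $\alpha>0$ with $\nabla\phi(x)\cdot\nu\ge\alpha$ for all $x\in\partial\mathcal O$, $\nu\in\nu(x)$; 3. there are $n\ge 1$, $\lambda>0$, $R>0$, $a_1,\dots,a_n\in\mathbb S^{d-1}$ and $x_1,\dots,x_n\in\partial\mathcal O$ such that $\partial\mathcal O\subseteq\bigcup_i B(x_i,R)$, and $\nu\cdot a_i\ge\lambda$ whenever $x\in\partial\mathcal O\cap B(x_i,2R)$ and $\nu\in\nu(x)$. Let $\sigma:\bar{\mathcal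 O}\to\mathrm{Hom}(\mathbb R^r;\mathbb R^d)$ be Lipschitz continuous, and let $w\in C([0,\infty);\mathbb R^r)$ be piecewise smooth: there are $0=t_0<t_1<\cdots\to\infty$ such that $w$ is continuously differentiable on each $[t_n,t_{n+1}]$ (one-sidedly at the endpoints), and $\int_0^t\sigma(y_s)\,dw_s=\int_0^t\sigma(y_s)\dot w_s\,ds$. For $f:[0,\infty)\to\mathbb R^d$, a solution of the Skorohod problem with input $f$ is a pair $(x,\ell)$ with $x\in C([0,\infty);\bar{\mathcal O})$ and $\ell\in C([0,\infty);\mathbb R^d)$ of locally bounded variation such that, for all $t\ge 0$, $$x_t=f_t+\ell_t,\qquad |\ell|_t=\int_0^t 1_{\partial\mathcal O}(x_s)\,d|\ell|_s,\qquad \ell_t=\int_0^t\frac{d\ell_s}{d|\ell|_s}\,d|\ell|_s\ \text{ with }\ \frac{d\ell_s}{d|\ell|_s}\in\nu(x_s)\ \text{ for } d|\ell|\text{-a.e. } s,$$ where $|\ell|_t$ is the total variation of $\ell$ on $[0,t]$. The Skorohod map $\Gamma$ sends $f$ to $x$. For $x_0\in\bar{\mathcal O}$ and $y\in C([0,\infty);\bar{\mathcal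 O})$ put $F_w(y)=\Gamma\bigl(x_0+\int_0^{\cdot}\sigma(y_s)\,dw_s\bigr)$. Then: (a) $F_w:C([0,\infty);\bar{\mathcal O})\to C([0,\infty);\bar{\mathcal O})$ is well defined: for all $x_0\in\bar{\mathcal O}$ and $y\in C([0,\infty);\bar{\mathcal O})$ the Skorohod problem with input $x_0+\int_0^{\cdot}\sigma(y_s)\,dw_s$ has exactly one solution. (b) For each $T>0$ there is $C=C_w(T)<\infty$ such that, for all $x_0\in\bar{\mathcal O}$, all $y,y'\in C([0,\infty);\bar{\mathcal O})$ and all $t\in[0,T]$, $$|F_w(y)_t-F_w(y')_t|^2\le\int_0^t e^{C(t-\tau)}|y_\tau-y'_\tau|^2\,d\tau .$$ (c) For each $x_0\in\bar{\mathcal O}$, $F_w$ has exactly one fixed point, the reflected ODE $$x_t=x_0+\int_0^t\sigma(x_s)\,dw_s+\ell_t,\qquad |\ell|_t=\int_0^t 1_{\partial\mathcal O}(x_s)\,d|\ell|_s,\qquad \ell_t=\int_0^t\nu(x_s)\,d|\ell|_s$$ (the last two conditions as in the Skorohod problem) has exactly one solution $(x,\ell)$, with $x\in C([0,\infty);\bar{\mathcal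 O})$ and $\ell\in C([0,\infty);\mathbb R^d)$ of locally bounded variation, and the fixed point is the first component $x$ of this solution. -/

import Mathlib

open Set Filter Topology MeasureTheory
open scoped NNReal ENNReal

namespace ReflectedODE

/-- The set `ν(x)` of inward pointing unit proximal normal vectors to `O` at `x`. -/
def inwardNormals {d : ℕ} (O : Set (EuclideanSpace ℝ (Fin d))) (x : EuclideanSpace ℝ (Fin d)) :
    Set (EuclideanSpace ℝ (Fin d)) :=
  {v | ‖v‖ = 1 ∧ ∃ C : ℝ, 0 < C ∧ ∀ x' ∈ closure O, 0 ≤ inner ℝ (x' - x) v + C * ‖x - x'‖ ^ 2}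

/-- Admissible sets: uniform exterior balls, a `C²` function whose gradient is uniformly
transversal to the normals, and local uniform transversality to finitely many directions. -/
structure IsAdmissible {d : ℕ} (O : Set (EuclideanSpace ℝ (Fin d))) : Prop where
  normals_nonempty : ∀ x ∈ frontier O, (inwardNormals O x).Nonempty
  uniform_exterior_ball : ∃ C₀ : ℝ, 0 ≤ C₀ ∧ ∀ x' ∈ O, ∀ x ∈ frontier O,
    ∀ v ∈ inwardNormals O x, 0 ≤ inner ℝ (x' - x) v + C₀ * ‖x - x'‖ ^ 2
  transversal_function : ∃ (φ : EuclideanSpace ℝ (Fin d) → ℝ) (α : ℝ), ContDiff ℝ 2 φ ∧ 0 < α ∧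
    ∀ x ∈ frontier O, ∀ v ∈ inwardNormals O x, α ≤ inner ℝ (gradient φ x) v
  local_directions : ∃ (n : ℕ) (lam R : ℝ) (a p : Fin n → EuclideanSpace ℝ (Fin d)),
    1 ≤ n ∧ 0 < lam ∧ 0 < R ∧ (∀ i, ‖a i‖ = 1) ∧ (∀ i, p i ∈ frontier O) ∧
    frontier O ⊆ ⋃ i, Metric.ball (p i) R ∧
    ∀ i, ∀ x ∈ frontier O ∩ Metric.ball (p i) (2 * R), ∀ v ∈ inwardNormals O x,
      lam ≤ inner ℝ v (a i)

/-- A continuous path `w : [0, ∞) → F` is piecewise smooth if `[0, ∞)` is divided by breakpoints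
`0 = t₀ < t₁ < ⋯ → ∞` such that `w` is continuously differentiable on every `[tₙ, tₙ₊₁]`
(one-sidedly at the endpoints). -/
def IsPiecewiseSmooth {F : Type*} [NormedAddCommGroup F] [NormedSpace ℝ F]
    (w : C(ℝ≥0, F)) : Prop :=
  ∃ t : ℕ → ℝ, t 0 = 0 ∧ StrictMono t ∧ Tendsto t atTop atTop ∧
    ∀ n, ContDiffOn ℝ 1 (fun s : ℝ => w s.toNNReal) (Icc (t n) (t (n + 1)))

/-- The total variation `t ↦ |ℓ|_t` of a continuous path of locally bounded variation, as a
nondecreasing right-continuous function on `[0, ∞)`. -/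
noncomputable def totalVariation {E : Type*} [NormedAddCommGroup E] (ℓ : C(ℝ≥0, E))
    (h : LocallyBoundedVariationOn ℓ univ) : StieltjesFunction ℝ≥0 where
  toFun t := variationOnFromTo ℓ univ 0 t
  mono' := monotoneOn_univ.1 (variationOnFromTo.monotoneOn h (mem_univ 0))
  right_continuous' t := by
    have key := variationOnFromTo.tendsto_right (s := univ) (l := ℓ t) (mem_univ (0 : ℝ≥0))
      (mem_univ t) h (by simpa using (ℓ.continuous.tendsto t).mono_left nhdsWithin_le_nhds)
    rw [← continuousWithinAt_Ioi_iff_Ici]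
    simpa [ContinuousWithinAt] using key

/-- The measure `d|ℓ|` on `[0, ∞)`. -/
noncomputable def variationMeasure {E : Type*} [NormedAddCommGroup E] (ℓ : C(ℝ≥0, E))
    (h : LocallyBoundedVariationOn ℓ univ) : Measure ℝ≥0 :=
  (totalVariation ℓ h).measure

/-- The conditions on the reflection term `ℓ` of a path `x` in `closure O`: `ℓ` has locally
bounded variation, `|ℓ|_t = ∫₀ᵗ 1_{∂O}(x_s) d|ℓ|_s`, and `ℓ_t = ∫₀ᵗ n_s d|ℓ|_s` for a density
`n = dℓ/d|ℓ|` with `n_s ∈ ν(x_s)` for `d|ℓ|`-almost every `s`. -/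
def IsReflectionTerm {d : ℕ} (O : Set (EuclideanSpace ℝ (Fin d))) (x : C(ℝ≥0, closure O))
    (ℓ : C(ℝ≥0, EuclideanSpace ℝ (Fin d))) : Prop :=
  ∃ h : LocallyBoundedVariationOn ℓ univ,
    (∀ t : ℝ≥0, eVariationOn ℓ (Icc 0 t) =
      ∫⁻ s in Icc 0 t, (frontier O).indicator 1 (x s : EuclideanSpace ℝ (Fin d))
        ∂variationMeasure ℓ h) ∧
    ∃ n : ℝ≥0 → EuclideanSpace ℝ (Fin d),
      AEStronglyMeasurable n (variationMeasure ℓ h) ∧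
      (∀ᵐ s ∂variationMeasure ℓ h, n s ∈ inwardNormals O (x s)) ∧
      ∀ t : ℝ≥0, ℓ t = ∫ s in Icc 0 t, n s ∂variationMeasure ℓ h

/-- `(x, ℓ)` solves the Skorohod problem in `O` with normal reflection for the input `f`. -/
def IsSkorohodSolution {d : ℕ} (O : Set (EuclideanSpace ℝ (Fin d)))
    (f : ℝ≥0 → EuclideanSpace ℝ (Fin d)) (x : C(ℝ≥0, closure O))
    (ℓ : C(ℝ≥0, EuclideanSpace ℝ (Fin d))) : Prop :=
  (∀ t, (x t : EuclideanSpace ℝ (Fin d)) = f t + ℓ t) ∧ IsReflectionTerm O x ℓ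

open Classical in
/-- The Skorohod map `Γ`, which sends an input starting in `closure O` to the output `x` of the
solution `(x, ℓ)` of the Skorohod problem (to a constant path if there is no solution). -/
noncomputable def skorohodMap {d : ℕ} (O : Set (EuclideanSpace ℝ (Fin d)))
    (f : ℝ≥0 → EuclideanSpace ℝ (Fin d)) (hf : f 0 ∈ closure O) : C(ℝ≥0, closure O) :=
  if h : ∃ x ℓ, IsSkorohodSolution O f x ℓ then h.choose
  else ContinuousMap.const ℝ≥0 ⟨f 0, hf⟩

/-- The path `t ↦ x₀ + ∫₀ᵗ σ(y_s) dw_s`, where `dw_s = ẇ_s ds`. -/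
noncomputable def drivenPath {d r : ℕ} {O : Set (EuclideanSpace ℝ (Fin d))}
    (σ : closure O → EuclideanSpace ℝ (Fin r) →L[ℝ] EuclideanSpace ℝ (Fin d))
    (w : C(ℝ≥0, EuclideanSpace ℝ (Fin r))) (x₀ : closure O) (y : C(ℝ≥0, closure O)) :
    ℝ≥0 → EuclideanSpace ℝ (Fin d) :=
  fun t => (x₀ : EuclideanSpace ℝ (Fin d)) +
    ∫ s in (0 : ℝ)..t, σ (y s.toNNReal) (deriv (fun u : ℝ => w u.toNNReal) s)

theorem drivenPath_zero_mem {d r : ℕ} {O : Set (EuclideanSpace ℝ (Fin d))}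
    (σ : closure O → EuclideanSpace ℝ (Fin r) →L[ℝ] EuclideanSpace ℝ (Fin d))
    (w : C(ℝ≥0, EuclideanSpace ℝ (Fin r))) (x₀ : closure O) (y : C(ℝ≥0, closure O)) :
    drivenPath σ w x₀ y 0 ∈ closure O := by
  simp [drivenPath]

/-- The map `F_w(y) = Γ(x₀ + ∫₀ σ(y_s) dw_s)` on `C([0, ∞); closure O)`. -/
noncomputable def picardMap {d r : ℕ} {O : Set (EuclideanSpace ℝ (Fin d))}
    (σ : closure O → EuclideanSpace ℝ (Fin r) →L[ℝ] EuclideanSpace ℝ (Fin d))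
    (w : C(ℝ≥0, EuclideanSpace ℝ (Fin r))) (x₀ : closure O) (y : C(ℝ≥0, closure O)) :
    C(ℝ≥0, closure O) :=
  skorohodMap O (drivenPath σ w x₀ y) (drivenPath_zero_mem σ w x₀ y)

/-- `(x, ℓ)` solves the reflected equation `x_t = x₀ + ∫₀ᵗ σ(x_s) dw_s + ℓ_t`. -/
def IsReflectedSolution {d r : ℕ} {O : Set (EuclideanSpace ℝ (Fin d))}
    (σ : closure O → EuclideanSpace ℝ (Fin r) →L[ℝ] EuclideanSpace ℝ (Fin d))
    (w : C(ℝ≥0, EuclideanSpace ℝ (Fin r))) (x₀ : closure O) (x : C(ℝ≥0, closure O))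
    (ℓ : C(ℝ≥0, EuclideanSpace ℝ (Fin d))) : Prop :=
  (∀ t : ℝ≥0, (x t : EuclideanSpace ℝ (Fin d)) =
    x₀ + (∫ s in (0 : ℝ)..t, σ (x s.toNNReal) (deriv (fun u : ℝ => w u.toNNReal) s)) + ℓ t) ∧
  IsReflectionTerm O x ℓ

end ReflectedODE

/-! Everything reduces to inputs that are Lipschitz on bounded time intervals, because `w` is
piecewise C¹ and `σ` is bounded on the compact closure of `O`. For a Lipschitz reflection term the
condition dℓ ∈ ν(x) d|ℓ| is encoded by the inequality `ReflectsLipschitz`, tested against all points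
of the closure. It contains no measure and no derivative, so it passes to pointwise limits and
survives time changes, while differentiating it recovers a normal
(`ReflectsLipschitz.deriv_eq_zero_or_mem`).

Comparison (`IsAdmissible.exists_comparison`): the exterior balls only give 2⟨x - x', dℓ - dℓ'⟩ ≤
2C₀|x - x'|²(d|ℓ| + d|ℓ'|). Since the reflection raises φ(x) at rate at least α d|ℓ|, the weight
exp(-(2C₀/α)(φ(x) + φ(x'))) absorbs the right-hand side. As φ is bounded on the closure, the weight
costs only a constant factor, which a small Young parameter compensates. This yields both the
estimate (b) and uniqueness among Lipschitz reflection terms.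

Existence (`IsAdmissible.exists_reflectsLipschitz`) comes from Euler steps followed by projection
onto the closure. Uniqueness among all reflection terms of bounded variation
(`IsSkorohodSolution.reflectsLipschitz`) comes from the clock inverse to t + |ℓ|_t. Under it an
arbitrary solution becomes Lipschitz and must agree with the Euler solution run by the same clock.
The clock is onto, so the two agree in the original time.

For (c), the estimate (b) is a contraction in an exponentially weighted sup norm on each bounded
interval (`IsAdmissible.exists_weighted_contraction`), and a reflected solution is a Skorohod
solution whose input is driven by its own first component. -/

namespace ReflectedODE

/-! ### Proximal normals on the closure of the domain. -/

section Geometry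

variable {d : ℕ} {O : Set (EuclideanSpace ℝ (Fin d))}

theorem inwardNormals_eq_empty_of_mem (hO : IsOpen O) {x : EuclideanSpace ℝ (Fin d)} (hx : x ∈ O) :
    inwardNormals O x = ∅ := by
  refine eq_empty_iff_forall_notMem.2 ?_
  rintro v ⟨hv, C, hC, h⟩
  obtain ⟨ε, hε, hball⟩ := Metric.isOpen_iff.1 hO x hx
  -- Moving from x by δ against v stays in O and gives 0 ≤ -δ + Cδ², which is impossible once Cδ ≤
  -- 1/2.
  set δ := min (ε / 2) (1 / (2 * C)) with hδ
  have hδ0 : 0 < δ := lt_min (by linarith) (by positivity)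
  have hmem : x - δ • v ∈ O := hball (by
    rw [Metric.mem_ball, dist_eq_norm, sub_sub_cancel_left, norm_neg, norm_smul, hv,
      Real.norm_of_nonneg hδ0.le]
    have := min_le_left (ε / 2) (1 / (2 * C))
    linarith)
  have key := h _ (subset_closure hmem)
  rw [sub_sub_cancel_left, sub_sub_cancel, inner_neg_left, real_inner_smul_left,
    real_inner_self_eq_norm_sq, norm_smul, hv, Real.norm_of_nonneg hδ0.le] at key
  have h2 : δ * C ≤ 1 / 2 := by
    have := mul_le_mul_of_nonneg_right (min_le_right (ε / 2) (1 / (2 * C))) hC.le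
    rwa [show 1 / (2 * C) * C = 1 / 2 by field_simp] at this
  nlinarith

theorem mem_frontier_of_mem_inwardNormals (hO : IsOpen O) {x v : EuclideanSpace ℝ (Fin d)}
    (hx : x ∈ closure O) (hv : v ∈ inwardNormals O x) : x ∈ frontier O := by
  rw [hO.frontier_eq]
  refine ⟨hx, fun hxO => ?_⟩
  rw [inwardNormals_eq_empty_of_mem hO hxO] at hv
  exact hv

/-- The inequality is a closed condition on the test point, hence extends from O to its closure. The
base point may be anywhere in the closure because interior points have no normals. -/
theorem IsAdmissible.exists_uniform_ball (h : IsAdmissible O) (hO : IsOpen O) :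
    ∃ C₀ : ℝ, 0 ≤ C₀ ∧ ∀ x ∈ closure O, ∀ v ∈ inwardNormals O x, ∀ z ∈ closure O,
      0 ≤ inner ℝ (z - x) v + C₀ * ‖z - x‖ ^ 2 := by
  obtain ⟨C₀, hC₀, hball⟩ := h.uniform_exterior_ball
  refine ⟨C₀, hC₀, fun x hx v hv z hz => ?_⟩
  have hcl : IsClosed {z : EuclideanSpace ℝ (Fin d) |
      0 ≤ inner ℝ (z - x) v + C₀ * ‖z - x‖ ^ 2} := isClosed_le (by fun_prop) (by fun_prop)
  refine closure_minimal (fun y hy => ?_) hcl hz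
  have := hball y hy x (mem_frontier_of_mem_inwardNormals hO hx hv) v hv
  rwa [norm_sub_rev] at this

theorem IsAdmissible.exists_transversal (h : IsAdmissible O) (hO : IsOpen O) :
    ∃ (φ : EuclideanSpace ℝ (Fin d) → ℝ) (α : ℝ), ContDiff ℝ 1 φ ∧ 0 < α ∧
      ∀ x ∈ closure O, ∀ v ∈ inwardNormals O x, α ≤ fderiv ℝ φ x v := by
  obtain ⟨φ, α, hφ, hα, hb⟩ := h.transversal_function
  refine ⟨φ, α, hφ.of_le (by norm_num), hα, fun x hx v hv => ?_⟩
  have := hb x (mem_frontier_of_mem_inwardNormals hO hx hv) v hv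
  rwa [gradient, InnerProductSpace.toDual_symm_apply] at this

end Geometry

/-! ### Lipschitz paths and the integrated reflection condition. -/

/-- `f` is Lipschitz on bounded time intervals. -/
def LipschitzOnBounded {E : Type*} [PseudoEMetricSpace E] (f : ℝ≥0 → E) : Prop :=
  ∀ T : ℝ≥0, ∃ C : ℝ≥0, LipschitzOnWith C f (Iic T)

/-- An integrated form of the inclusion `dℓ ∈ ν(x) d|ℓ|` for paths that are Lipschitz on bounded
time intervals. -/
def ReflectsLipschitz {d : ℕ} (O : Set (EuclideanSpace ℝ (Fin d)))
    (x ℓ : ℝ≥0 → EuclideanSpace ℝ (Fin d)) : Prop :=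
  ∀ T : ℝ≥0, ∃ C : ℝ≥0, LipschitzOnWith C ℓ (Iic T) ∧
    ∀ s t, s ≤ t → t ≤ T → ∀ z ∈ closure O,
      0 ≤ inner ℝ (z - x s) (ℓ t - ℓ s) + C * ((t : ℝ) - s) * ‖z - x s‖ ^ 2
        + C * ((t : ℝ) - s) ^ 2

theorem lipschitzOnWith_comp_toNNReal {E : Type*} [PseudoEMetricSpace E] {f : ℝ≥0 → E} {C T : ℝ≥0}
    (h : LipschitzOnWith C f (Iic T)) :
    LipschitzOnWith C (fun s : ℝ => f s.toNNReal) (Iic (T : ℝ)) := by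
  intro a ha b hb
  have hm : ∀ a ∈ Iic (T : ℝ), a.toNNReal ∈ Iic T := fun a ha => Real.toNNReal_le_iff_le_coe.2 ha
  refine (h (hm a ha) (hm b hb)).trans ?_
  gcongr
  rw [edist_dist, edist_dist, NNReal.dist_eq, Real.dist_eq]
  exact ENNReal.ofReal_le_ofReal (abs_max_sub_max_le_abs a b 0)

theorem LipschitzOnBounded.ae_differentiableAt {E : Type*} [NormedAddCommGroup E] [NormedSpace ℝ E]
    [FiniteDimensional ℝ E] {f : ℝ≥0 → E} (h : LipschitzOnBounded f) :
    ∀ᵐ s : ℝ, DifferentiableAt ℝ (fun s : ℝ => f s.toNNReal) s := by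
  have : ∀ n : ℕ, ∀ᵐ s : ℝ, s ∈ Iic ((n : ℝ≥0) : ℝ) →
      DifferentiableWithinAt ℝ (fun s : ℝ => f s.toNNReal) (Iic ((n : ℝ≥0) : ℝ)) s := fun n => by
    obtain ⟨C, hC⟩ := h n
    exact (lipschitzOnWith_comp_toNNReal hC).ae_differentiableWithinAt_of_mem_real
  filter_upwards [ae_all_iff.2 this] with s hs
  obtain ⟨n, hn⟩ := exists_nat_gt s
  exact (hs n (by simpa using hn.le)).differentiableAt (Iic_mem_nhds (by simpa using hn))

theorem LipschitzOnWith.absolutelyContinuous_toNNReal {E : Type*} [PseudoMetricSpace E]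
    {f : ℝ≥0 → E} {C T : ℝ≥0} (h : LipschitzOnWith C f (Iic T)) {a b : ℝ} (ha : a ≤ T)
    (hb : b ≤ T) : AbsolutelyContinuousOnInterval (fun s : ℝ => f s.toNNReal) a b :=
  ((lipschitzOnWith_comp_toNNReal h).mono
    (fun _ hs => hs.2.trans (sup_le ha hb))).absolutelyContinuousOnInterval

theorem sub_le_integral_of_ae_deriv_le {h k : ℝ → ℝ} {a b : ℝ} (hab : a ≤ b)
    (hh : AbsolutelyContinuousOnInterval h a b) (hk : IntervalIntegrable k volume a b)
    (hle : ∀ᵐ s, s ∈ Ioo a b → deriv h s ≤ k s) : h b - h a ≤ ∫ s in a..b, k s := by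
  rw [← hh.integral_deriv_eq_sub]
  refine intervalIntegral.integral_mono_ae_restrict hab hh.intervalIntegrable_deriv hk ?_
  rw [← restrict_Ioo_eq_restrict_Icc]
  exact (ae_restrict_iff' measurableSet_Ioo).2 hle

/-- A derivative of the reflection term vanishes or is a positive multiple of a normal. -/
theorem ReflectsLipschitz.deriv_eq_zero_or_mem {d : ℕ} {O : Set (EuclideanSpace ℝ (Fin d))}
    {x ℓ : ℝ≥0 → EuclideanSpace ℝ (Fin d)} (h : ReflectsLipschitz O x ℓ) {s : ℝ} (hs : 0 < s)
    (hd : DifferentiableAt ℝ (fun s : ℝ => ℓ s.toNNReal) s) :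
    deriv (fun s : ℝ => ℓ s.toNNReal) s = 0 ∨
      ‖deriv (fun s : ℝ => ℓ s.toNNReal) s‖⁻¹ • deriv (fun s : ℝ => ℓ s.toNNReal) s
        ∈ inwardNormals O (x s.toNNReal) := by
  obtain ⟨C, -, hC⟩ := h (s.toNNReal + 1)
  set v := deriv (fun s : ℝ => ℓ s.toNNReal) s with hv
  -- Divide the integrated inequality by t - s and let t decrease to s: the quadratic error in time
  -- disappears.
  have key : ∀ z ∈ closure O, 0 ≤ inner ℝ (z - x s.toNNReal) v + C * ‖z - x s.toNNReal‖ ^ 2 := by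
    intro z hz
    have hlim := (hasDerivWithinAt_iff_tendsto_slope' (notMem_Ioi.2 le_rfl)).1
      (hd.hasDerivAt.hasDerivWithinAt (s := Ioi s))
    have hlim2 : Tendsto (fun t : ℝ => inner ℝ (z - x s.toNNReal)
        (slope (fun s : ℝ => ℓ s.toNNReal) s t) + C * ‖z - x s.toNNReal‖ ^ 2 + C * (t - s))
        (𝓝[>] s) (𝓝 (inner ℝ (z - x s.toNNReal) v + C * ‖z - x s.toNNReal‖ ^ 2 + C * (s - s))) :=
      ((tendsto_const_nhds.inner hlim).add tendsto_const_nhds).add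
        ((Continuous.tendsto (by fun_prop) s).mono_left nhdsWithin_le_nhds)
    rw [sub_self, mul_zero, add_zero] at hlim2
    refine ge_of_tendsto hlim2 ?_
    filter_upwards [Ioo_mem_nhdsGT (lt_add_one s)] with t ht
    have ht0 : 0 < t := hs.trans ht.1
    have := hC s.toNNReal t.toNNReal (Real.toNNReal_le_toNNReal ht.1.le)
      (by rw [← Real.toNNReal_one, ← Real.toNNReal_add hs.le zero_le_one]
          exact Real.toNNReal_le_toNNReal ht.2.le) z hz
    rw [Real.coe_toNNReal _ hs.le, Real.coe_toNNReal _ ht0.le] at this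
    rw [slope_def_module, real_inner_smul_right]
    have h1 : 0 < t - s := sub_pos.2 ht.1
    have h2 := mul_nonneg (inv_nonneg.2 h1.le) this
    refine h2.trans_eq ?_
    field_simp
  by_cases h0 : v = 0
  · exact Or.inl h0
  have hv0 : 0 < ‖v‖ := norm_pos_iff.2 h0
  -- The summand 1 only serves to make the constant positive, as C may vanish.
  refine Or.inr ⟨norm_smul_inv_norm h0, ‖v‖⁻¹ * C + 1, by positivity, fun z hz => ?_⟩
  have := mul_nonneg (inv_nonneg.2 hv0.le) (key z hz)
  rw [real_inner_smul_right, norm_sub_rev]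
  nlinarith [sq_nonneg ‖z - x s.toNNReal‖]

/-- The variational inequality of a reflection term, as a bound on the angle with its velocity. -/
theorem inner_add_mul_norm_nonneg_of_eq_zero_or_mem {d : ℕ} {O : Set (EuclideanSpace ℝ (Fin d))}
    {C₀ : ℝ} {x v z : EuclideanSpace ℝ (Fin d)}
    (hC₀ : ∀ v ∈ inwardNormals O x, 0 ≤ inner ℝ (z - x) v + C₀ * ‖z - x‖ ^ 2)
    (hv : v = 0 ∨ ‖v‖⁻¹ • v ∈ inwardNormals O x) :
    0 ≤ inner ℝ (z - x) v + C₀ * ‖v‖ * ‖z - x‖ ^ 2 := by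
  rcases eq_or_ne v 0 with rfl | h0
  · simp
  have h1 := mul_nonneg (norm_nonneg v) (hC₀ _ (hv.resolve_left h0))
  rw [real_inner_smul_right, mul_add, mul_inv_cancel_left₀ (norm_ne_zero_iff.2 h0)] at h1
  linarith

theorem mul_norm_le_fderiv_of_eq_zero_or_mem {d : ℕ} {O : Set (EuclideanSpace ℝ (Fin d))}
    {φ : EuclideanSpace ℝ (Fin d) → ℝ} {α : ℝ} {x v : EuclideanSpace ℝ (Fin d)}
    (hα : ∀ v ∈ inwardNormals O x, α ≤ fderiv ℝ φ x v)
    (hv : v = 0 ∨ ‖v‖⁻¹ • v ∈ inwardNormals O x) :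
    α * ‖v‖ ≤ fderiv ℝ φ x v := by
  rcases eq_or_ne v 0 with rfl | h0
  · simp
  have h1 := mul_le_mul_of_nonneg_left (hα _ (hv.resolve_left h0)) (norm_nonneg v)
  rw [map_smul, smul_eq_mul, mul_inv_cancel_left₀ (norm_ne_zero_iff.2 h0)] at h1
  linarith

end ReflectedODE

/-! ### Comparison of reflected paths by a weighted distance. -/

namespace ReflectedODE

theorem exists_lipschitzOnWith_contDiff_comp {F G : Type*} [NormedAddCommGroup F] [NormedSpace ℝ F]
    [NormedAddCommGroup G] [NormedSpace ℝ G] {Φ : F → G} (hΦ : ContDiff ℝ 1 Φ) {γ : ℝ → F}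
    {C : ℝ≥0} {a b : ℝ} (hγ : LipschitzOnWith C γ (Icc a b)) :
    ∃ K, LipschitzOnWith K (fun s => Φ (γ s)) (Icc a b) := by
  obtain ⟨K, hK⟩ := (hΦ.locallyLipschitz.locallyLipschitzOn (s := γ '' Icc a b)
    ).exists_lipschitzOnWith_of_compact (isCompact_Icc.image_of_continuousOn hγ.continuousOn)
  exact ⟨K * C, hK.comp hγ (mapsTo_image _ _)⟩

theorem ReflectsLipschitz.lipschitzOnBounded {d : ℕ} {O : Set (EuclideanSpace ℝ (Fin d))}
    {x ℓ : ℝ≥0 → EuclideanSpace ℝ (Fin d)} (h : ReflectsLipschitz O x ℓ) : LipschitzOnBounded ℓ :=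
  fun T => (h T).imp fun _ hC => hC.1

theorem LipschitzOnBounded.add {E : Type*} [NormedAddCommGroup E] {f g : ℝ≥0 → E}
    (hf : LipschitzOnBounded f) (hg : LipschitzOnBounded g) :
    LipschitzOnBounded (fun t => f t + g t) := fun T => by
  obtain ⟨C, hC⟩ := hf T
  obtain ⟨D, hD⟩ := hg T
  exact ⟨C + D, hC.add hD⟩

/-- The pointwise estimate behind the comparison of two reflected paths `x`, `x'` with velocities
`p + v`, `p' + v'`: the penalty terms `A`, `A'` absorb the contribution of the reflection. -/
theorem velocity_estimate {E : Type*} [NormedAddCommGroup E] [InnerProductSpace ℝ E]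
    {x x' p p' v v' : E} {C₀ α δ G L a a' b b' : ℝ} (hC₀ : 0 ≤ C₀) (hα : 0 < α) (hδ : 0 < δ)
    (h1 : 0 ≤ inner ℝ (x' - x) v + C₀ * ‖v‖ * ‖x' - x‖ ^ 2)
    (h2 : 0 ≤ inner ℝ (x - x') v' + C₀ * ‖v'‖ * ‖x - x'‖ ^ 2)
    (hb : α * ‖v‖ ≤ b) (hb' : α * ‖v'‖ ≤ b') (ha : -(G * L) ≤ a) (ha' : -(G * L) ≤ a') :
    2 * inner ℝ (x - x') (p + v - (p' + v')) -
      (1 / δ + 2 * (2 * C₀ / α) * (G * L) + 2 * C₀ / α * ((a + b) + (a' + b'))) * ‖x - x'‖ ^ 2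
      ≤ δ * ‖p - p'‖ ^ 2 := by
  have e1 : inner ℝ (x - x') (p + v - (p' + v')) =
      inner ℝ (x - x') (p - p') + inner ℝ (x - x') v - inner ℝ (x - x') v' := by
    simp only [inner_sub_right, inner_add_right]; ring
  have e2 : inner ℝ (x' - x) v = - inner ℝ (x - x') v := by
    rw [← inner_neg_left, neg_sub]
  rw [e2, norm_sub_rev x' x] at h1
  have hcs : 2 * inner ℝ (x - x') (p - p') ≤ 1 / δ * ‖x - x'‖ ^ 2 + δ * ‖p - p'‖ ^ 2 := by
    have h := real_inner_le_norm (x - x') (p - p')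
    have h3 : 0 ≤ (‖x - x'‖ - δ * ‖p - p'‖) ^ 2 / δ := by positivity
    have h4 : (‖x - x'‖ - δ * ‖p - p'‖) ^ 2 / δ = 1 / δ * ‖x - x'‖ ^ 2
        + δ * ‖p - p'‖ ^ 2 - 2 * (‖x - x'‖ * ‖p - p'‖) := by
      field_simp; ring
    linarith
  have hc : 0 ≤ 2 * C₀ / α := by positivity
  -- The factor 2C₀/α turns the growth α‖v‖ of φ into the required 2C₀‖v‖; the term with G * L
  -- compensates for a possible decrease of φ along the input velocity.
  have hS : 2 * C₀ * (‖v‖ + ‖v'‖) ≤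
      2 * (2 * C₀ / α) * (G * L) + 2 * C₀ / α * ((a + b) + (a' + b')) := by
    have h5 := mul_le_mul_of_nonneg_left (add_le_add (add_le_add ha hb) (add_le_add ha' hb')) hc
    have h6 : 2 * C₀ / α * (-(G * L) + α * ‖v‖ + (-(G * L) + α * ‖v'‖)) =
        2 * C₀ * (‖v‖ + ‖v'‖) - 2 * (2 * C₀ / α) * (G * L) := by
      field_simp; ring
    linarith
  have := mul_le_mul_of_nonneg_right hS (sq_nonneg ‖x - x'‖)
  rw [e1]
  nlinarith

variable {d : ℕ} {O : Set (EuclideanSpace ℝ (Fin d))}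

/-- Comparison of two reflected paths with different inputs. -/
theorem IsAdmissible.exists_comparison (h : IsAdmissible O) (hO : IsOpen O)
    (hb : Bornology.IsBounded O) (L N : ℝ≥0) :
    ∃ C : ℝ, ∀ (T : ℝ≥0) (f f' x x' ℓ ℓ' : ℝ≥0 → EuclideanSpace ℝ (Fin d)) (g : ℝ → ℝ),
      (∀ t, x t ∈ closure O) → (∀ t, x' t ∈ closure O) →
      (∀ t, x t = f t + ℓ t) → (∀ t, x' t = f' t + ℓ' t) → x 0 = x' 0 →
      ReflectsLipschitz O x ℓ → ReflectsLipschitz O x' ℓ' →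
      LipschitzOnBounded f → LipschitzOnBounded f' →
      LipschitzOnWith L f (Iic T) → LipschitzOnWith L f' (Iic T) →
      (∀ s, 0 ≤ g s) → IntervalIntegrable g volume 0 T →
      (∀ᵐ s : ℝ, s ∈ Ioo (0 : ℝ) T → ‖deriv (fun s : ℝ => f s.toNNReal) s -
        deriv (fun s : ℝ => f' s.toNNReal) s‖ ^ 2 ≤ N * g s) →
      ‖x T - x' T‖ ^ 2 ≤ ∫ τ in (0 : ℝ)..T, Real.exp (C * (T - τ)) * g τ := by
  obtain ⟨C₀, hC₀, hball⟩ := h.exists_uniform_ball hO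
  obtain ⟨φ, α, hφ, hα, htrans⟩ := h.exists_transversal hO
  have hcomp : IsCompact (closure O) := hb.isCompact_closure
  obtain ⟨B, hB⟩ := hcomp.exists_bound_of_continuousOn hφ.continuous.continuousOn
  obtain ⟨G', hG'⟩ := hcomp.exists_bound_of_continuousOn
    (hφ.continuous_fderiv one_ne_zero).continuousOn
  set G := max G' 0
  have hG0 : 0 ≤ G := le_max_right _ _
  have hG : ∀ x ∈ closure O, ‖fderiv ℝ φ x‖ ≤ G := fun x hx => (hG' x hx).trans (le_max_left _ _)
  set c := 2 * C₀ / α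
  have hc : 0 ≤ c := by positivity
  -- Young parameter. The weight lies between exp(-2cB) and exp(2cB), so comparing it at two times
  -- costs exp(4cB). The bound δN ≤ exp(-4cB) then leaves the constant 1 in front of the final
  -- integral.
  set δ := Real.exp (-(4 * (c * B))) / (N + 1) with hδ_def
  have hδ : 0 < δ := by positivity
  -- The first term pays for Young's inequality, the second for the change of φ along the two
  -- inputs.
  set C := 1 / δ + 2 * c * (G * L) with hC
  refine ⟨C, fun T f f' x x' ℓ ℓ' g hx hx' hxf hxf' h0 hR hR' hf hf' hfL hfL' hg hgi hfg => ?_⟩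
  have hxL : LipschitzOnBounded x := by
    have := hf.add hR.lipschitzOnBounded
    rwa [← funext hxf] at this
  have hxL' : LipschitzOnBounded x' := by
    have := hf'.add hR'.lipschitzOnBounded
    rwa [← funext hxf'] at this
  let Φ : ℝ × EuclideanSpace ℝ (Fin d) × EuclideanSpace ℝ (Fin d) → ℝ :=
    fun q => Real.exp (-(C * q.1 + c * (φ q.2.1 + φ q.2.2))) * ‖q.2.1 - q.2.2‖ ^ 2
  have hΦ : ContDiff ℝ 1 Φ := by
    have hφ1 : ContDiff ℝ 1
        fun q : ℝ × EuclideanSpace ℝ (Fin d) × EuclideanSpace ℝ (Fin d) => φ q.2.1 :=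
      hφ.comp (contDiff_fst.comp contDiff_snd)
    have hφ2 : ContDiff ℝ 1
        fun q : ℝ × EuclideanSpace ℝ (Fin d) × EuclideanSpace ℝ (Fin d) => φ q.2.2 :=
      hφ.comp (contDiff_snd.comp contDiff_snd)
    refine ContDiff.mul (ContDiff.exp ?_) (ContDiff.norm_sq ℝ ?_)
    · exact ((contDiff_const.mul contDiff_fst).add (contDiff_const.mul (hφ1.add hφ2))).neg
    · exact (contDiff_fst.comp contDiff_snd).sub (contDiff_snd.comp contDiff_snd)
  let D : ℝ → ℝ := fun s => Φ (s, x s.toNNReal, x' s.toNNReal)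
  have hDac : AbsolutelyContinuousOnInterval D 0 T := by
    obtain ⟨K, hK⟩ := hxL T
    obtain ⟨K', hK'⟩ := hxL' T
    have hsub : Icc (0 : ℝ) T ⊆ Iic (T : ℝ) := fun s hs => hs.2
    obtain ⟨K'', hK''⟩ := exists_lipschitzOnWith_contDiff_comp hΦ
      ((LipschitzWith.id.lipschitzOnWith).prodMk
        (((lipschitzOnWith_comp_toNNReal hK).mono hsub).prodMk
          ((lipschitzOnWith_comp_toNNReal hK').mono hsub)))
    refine LipschitzOnWith.absolutelyContinuousOnInterval (K := K'') ?_
    rwa [uIcc_of_le T.coe_nonneg]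
  have hwt : ∀ q q' : EuclideanSpace ℝ (Fin d), q ∈ closure O → q' ∈ closure O →
      |c * (φ q + φ q')| ≤ 2 * (c * B) := fun q q' hq hq' => by
    rw [abs_mul, abs_of_nonneg hc]
    have h1 := (abs_add_le (φ q) (φ q')).trans (add_le_add (hB q hq) (hB q' hq'))
    nlinarith
  have hderiv : ∀ᵐ s : ℝ, s ∈ Ioo (0 : ℝ) T →
      deriv D s ≤ Real.exp (-(2 * (c * B))) * (Real.exp (-(C * s)) * g s) := by
    filter_upwards [hf.ae_differentiableAt, hf'.ae_differentiableAt,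
      hR.lipschitzOnBounded.ae_differentiableAt, hR'.lipschitzOnBounded.ae_differentiableAt,
      hfg] with s df df' dl dl' hs1 hs
    have hT : Iic (T : ℝ) ∈ 𝓝 s := Iic_mem_nhds hs.2
    have hp := norm_deriv_le_of_lipschitzOn hT (lipschitzOnWith_comp_toNNReal hfL)
    have hp' := norm_deriv_le_of_lipschitzOn hT (lipschitzOnWith_comp_toNNReal hfL')
    have hv := hR.deriv_eq_zero_or_mem hs.1 dl
    have hv' := hR'.deriv_eq_zero_or_mem hs.1 dl'
    have hs2 := hs1 hs
    set p := deriv (fun s : ℝ => f s.toNNReal) s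
    set p' := deriv (fun s : ℝ => f' s.toNNReal) s
    set v := deriv (fun s : ℝ => ℓ s.toNNReal) s
    set v' := deriv (fun s : ℝ => ℓ' s.toNNReal) s
    have dX : HasDerivAt (fun s : ℝ => x s.toNNReal) (p + v) s := by
      simp_rw [hxf]
      exact df.hasDerivAt.add dl.hasDerivAt
    have dX' : HasDerivAt (fun s : ℝ => x' s.toNNReal) (p' + v') s := by
      simp_rw [hxf']
      exact df'.hasDerivAt.add dl'.hasDerivAt
    have hφd := hφ.differentiable one_ne_zero
    have dφ := (hφd (x s.toNNReal)).hasFDerivAt.comp_hasDerivAt s dX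
    have dφ' := (hφd (x' s.toNNReal)).hasFDerivAt.comp_hasDerivAt s dX'
    have dD := ((((hasDerivAt_id s).const_mul C).add ((dφ.add dφ').const_mul c)).neg.exp).mul
      (dX.sub dX').norm_sq
    have hDeq : deriv D s = _ := dD.deriv
    rw [hDeq]
    have hX := hx s.toNNReal
    have hX' := hx' s.toNNReal
    have hbd : ∀ y ∈ closure O, ∀ q : EuclideanSpace ℝ (Fin d), ‖q‖ ≤ L →
        -(G * L) ≤ fderiv ℝ φ y q := fun y hy q hq => by
      have := (fderiv ℝ φ y).le_opNorm q
      rw [Real.norm_eq_abs] at this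
      have h3 : ‖fderiv ℝ φ y‖ * ‖q‖ ≤ G * L :=
        mul_le_mul (hG y hy) hq (norm_nonneg _) hG0
      linarith [neg_abs_le (fderiv ℝ φ y q)]
    have key := velocity_estimate hC₀ hα hδ (p := p) (p' := p') (G := G) (L := L)
      (inner_add_mul_norm_nonneg_of_eq_zero_or_mem (fun v hv => hball _ hX v hv _ hX') hv)
      (inner_add_mul_norm_nonneg_of_eq_zero_or_mem (fun v hv => hball _ hX' v hv _ hX) hv')
      (mul_norm_le_fderiv_of_eq_zero_or_mem (htrans _ hX) hv)
      (mul_norm_le_fderiv_of_eq_zero_or_mem (htrans _ hX') hv')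
      (hbd _ hX p hp) (hbd _ hX' p' hp')
    set w := c * (φ (x s.toNNReal) + φ (x' s.toNNReal)) with hw
    have hwb := abs_le.1 (hwt _ _ hX hX')
    have hE : Real.exp (-(C * s + w)) * δ * N ≤
        Real.exp (-(2 * (c * B))) * Real.exp (-(C * s)) := by
      have h1 : Real.exp (-(C * s + w)) ≤ Real.exp (-(C * s)) * Real.exp (2 * (c * B)) := by
        rw [← Real.exp_add]
        exact Real.exp_le_exp.2 (by linarith)
      have h2 : δ * N ≤ Real.exp (-(4 * (c * B))) := by
        rw [hδ_def, div_mul_eq_mul_div, div_le_iff₀ (by positivity)]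
        nlinarith [Real.exp_pos (-(4 * (c * B)))]
      calc Real.exp (-(C * s + w)) * δ * N = Real.exp (-(C * s + w)) * (δ * N) := by ring
        _ ≤ Real.exp (-(C * s)) * Real.exp (2 * (c * B)) * Real.exp (-(4 * (c * B))) := by gcongr
        _ = _ := by
          rw [← Real.exp_add, ← Real.exp_add, ← Real.exp_add]
          congr 1; ring
    have hE0 := Real.exp_pos (-(C * s + w))
    have h7 := mul_le_mul_of_nonneg_left key hE0.le
    have h8 : Real.exp (-(C * s + w)) * (δ * ‖p - p'‖ ^ 2) ≤
        Real.exp (-(2 * (c * B))) * (Real.exp (-(C * s)) * g s) := by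
      calc Real.exp (-(C * s + w)) * (δ * ‖p - p'‖ ^ 2)
          ≤ Real.exp (-(C * s + w)) * (δ * (N * g s)) := by gcongr
        _ = (Real.exp (-(C * s + w)) * δ * N) * g s := by ring
        _ ≤ _ := by
          rw [← mul_assoc]
          exact mul_le_mul_of_nonneg_right hE (hg s)
    refine le_trans (le_of_eq ?_) (h7.trans h8)
    simp only [Pi.add_apply, Function.comp, id, map_add, Pi.sub_apply, Pi.neg_apply]
    rw [← hw, hC]
    ring
  have hki : IntervalIntegrable (fun s => Real.exp (-(2 * (c * B))) * (Real.exp (-(C * s)) * g s))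
      volume 0 T := (hgi.continuousOn_mul (by fun_prop)).const_mul _
  have hfin := sub_le_integral_of_ae_deriv_le T.coe_nonneg hDac hki hderiv
  have hD0 : D 0 = 0 := by simp [D, Φ, h0]
  rw [hD0, sub_zero, intervalIntegral.integral_const_mul] at hfin
  have hDT : Real.exp (-(2 * (c * B))) * (Real.exp (-(C * T)) * ‖x T - x' T‖ ^ 2) ≤ D T := by
    have hwb := abs_le.1 (hwt _ _ (hx T) (hx' T))
    simp only [D, Φ, Real.toNNReal_coe]
    rw [← mul_assoc, ← Real.exp_add]
    gcongr
    linarith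
  have h9 := le_of_mul_le_mul_left (hDT.trans hfin) (Real.exp_pos _)
  have h10 := mul_le_mul_of_nonneg_left h9 (Real.exp_pos (C * T)).le
  rw [← mul_assoc, ← Real.exp_add, add_neg_cancel, Real.exp_zero, one_mul,
    ← intervalIntegral.integral_const_mul] at h10
  refine h10.trans_eq (intervalIntegral.integral_congr fun s _ => ?_)
  rw [← mul_assoc, ← Real.exp_add]
  congr 2; ring

end ReflectedODE

/-! ### Existence by the projected Euler scheme. -/

namespace ReflectedODE

variable {d : ℕ} {O : Set (EuclideanSpace ℝ (Fin d))}

/-- Without convexity nearest points need not be unique; any choice will do, and no continuity of P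
is needed. -/
theorem exists_projection {E : Type*} [NormedAddCommGroup E] {S : Set E} (hS : IsCompact S)
    (hne : S.Nonempty) :
    ∃ P : E → E, (∀ z, P z ∈ S) ∧ ∀ z, ∀ y ∈ S, ‖P z - z‖ ≤ ‖y - z‖ := by
  have : ∀ z, ∃ p ∈ S, ∀ y ∈ S, ‖p - z‖ ≤ ‖y - z‖ := fun z =>
    hS.exists_isMinOn hne (f := fun p => ‖p - z‖) (by fun_prop)
  choose P hP hP' using this
  exact ⟨P, hP, hP'⟩

/-- The displacement to a nearest point of a set is a multiple of a normal at that point. -/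
theorem eq_zero_or_mem_inwardNormals_of_nearest {z p : EuclideanSpace ℝ (Fin d)}
    (hp : ∀ y ∈ closure O, ‖p - z‖ ≤ ‖y - z‖) :
    p - z = 0 ∨ ‖p - z‖⁻¹ • (p - z) ∈ inwardNormals O p := by
  by_cases h0 : p - z = 0
  · exact Or.inl h0
  have hpos : 0 < ‖p - z‖ := norm_pos_iff.2 h0
  refine Or.inr ⟨norm_smul_inv_norm h0, ‖p - z‖⁻¹ / 2, by positivity, fun y hy => ?_⟩
  have h1 := pow_le_pow_left₀ (norm_nonneg _) (hp y hy) 2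
  rw [show y - z = (y - p) + (p - z) by abel, norm_add_sq_real] at h1
  rw [real_inner_smul_right, norm_sub_rev p y]
  have h2 := mul_nonneg (inv_nonneg.2 hpos.le)
    (show 0 ≤ inner ℝ (y - p) (p - z) + ‖y - p‖ ^ 2 / 2 by linarith)
  linarith

/-- One step of the projected Euler scheme changes the variational inequality by a controlled
amount. -/
theorem inner_step_bound {E : Type*} [NormedAddCommGroup E] [InnerProductSpace ℝ E]
    {z x x' Λ : E} {C₀ c R m : ℝ} (hC₀ : 0 ≤ C₀) (hΛ : ‖Λ‖ ≤ c)
    (hR : ‖z - x‖ ≤ R) (hR' : ‖z - x'‖ ≤ R) (hm : ‖x' - x‖ ≤ m)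
    (h : 0 ≤ inner ℝ (z - x') Λ + C₀ * ‖Λ‖ * ‖z - x'‖ ^ 2) :
    0 ≤ inner ℝ (z - x) Λ + C₀ * c * ‖z - x‖ ^ 2 + (2 * R * C₀ + 1) * m * c := by
  have hc : 0 ≤ c := (norm_nonneg _).trans hΛ
  have hm0 : 0 ≤ m := (norm_nonneg _).trans hm
  have hR0 : 0 ≤ R := (norm_nonneg _).trans hR
  have e : inner ℝ (z - x) Λ = inner ℝ (z - x') Λ + inner ℝ (x' - x) Λ := by
    rw [← inner_add_left]; congr 1; abel
  have h1 : -(m * c) ≤ inner ℝ (x' - x) Λ := by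
    have := abs_le.1 (abs_real_inner_le_norm (x' - x) Λ)
    have h2 := mul_le_mul hm hΛ (norm_nonneg _) hm0
    linarith
  have h3 : ‖z - x'‖ ^ 2 ≤ ‖z - x‖ ^ 2 + 2 * R * m := by
    have h4 : ‖z - x'‖ ≤ ‖z - x‖ + m := by
      have := norm_sub_norm_le (z - x') (z - x)
      rw [show z - x' - (z - x) = -(x' - x) by abel, norm_neg] at this
      linarith
    nlinarith [norm_nonneg (z - x'), norm_nonneg (z - x)]
  have h5 : C₀ * ‖Λ‖ * ‖z - x'‖ ^ 2 ≤ C₀ * c * (‖z - x‖ ^ 2 + 2 * R * m) := by gcongr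
  rw [e]
  nlinarith

/-- The projected Euler scheme for the increments of `u`. -/
def eulerScheme {E : Type*} [NormedAddCommGroup E] (P : E → E) (u : ℕ → E) : ℕ → E
  | 0 => u 0
  | k + 1 => P (eulerScheme P u k + (u (k + 1) - u k))

theorem eulerScheme_mem {E : Type*} [NormedAddCommGroup E] {S : Set E} {P : E → E}
    (hP : ∀ z, P z ∈ S) {u : ℕ → E} (hu : u 0 ∈ S) (k : ℕ) : eulerScheme P u k ∈ S := by
  cases k
  · exact hu
  · exact hP _

section Euler

variable {P : EuclideanSpace ℝ (Fin d) → EuclideanSpace ℝ (Fin d)}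
  {u : ℕ → EuclideanSpace ℝ (Fin d)} {n : ℕ} {c C₀ R : ℝ}

/-- The current iterate competes in the projection, so the correction is no longer than the input
step. -/
theorem norm_eulerScheme_increment (hP : ∀ z, P z ∈ closure O)
    (hP' : ∀ z, ∀ y ∈ closure O, ‖P z - z‖ ≤ ‖y - z‖) (hu : u 0 ∈ closure O)
    (hc : ∀ k < n, ‖u (k + 1) - u k‖ ≤ c) {k : ℕ} (hk : k < n) :
    ‖(eulerScheme P u (k + 1) - u (k + 1)) - (eulerScheme P u k - u k)‖ ≤ c := by
  have := hP' (eulerScheme P u k + (u (k + 1) - u k)) _ (eulerScheme_mem hP hu k)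
  rw [sub_add_cancel_left, norm_neg] at this
  refine le_trans (le_of_eq ?_) (this.trans (hc k hk))
  rw [eulerScheme]
  congr 1; abel

theorem norm_eulerScheme_sub_le (hP : ∀ z, P z ∈ closure O)
    (hP' : ∀ z, ∀ y ∈ closure O, ‖P z - z‖ ≤ ‖y - z‖) (hu : u 0 ∈ closure O)
    (hc : ∀ k < n, ‖u (k + 1) - u k‖ ≤ c) (j m : ℕ) (hm : j + m ≤ n) :
    ‖(eulerScheme P u (j + m) - u (j + m)) - (eulerScheme P u j - u j)‖ ≤ m * c ∧
      ‖eulerScheme P u (j + m) - eulerScheme P u j‖ ≤ 2 * m * c := by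
  induction m with
  | zero => simp
  | succ m ih =>
    obtain ⟨h1, h2⟩ := ih (by omega)
    have h3 := norm_eulerScheme_increment hP hP' hu hc (k := j + m) (by omega)
    have h4 := hc (j + m) (by omega)
    rw [← add_assoc]
    have h5 := norm_add_le (eulerScheme P u (j + m + 1) - u (j + m + 1) -
      (eulerScheme P u (j + m) - u (j + m)))
      (eulerScheme P u (j + m) - u (j + m) - (eulerScheme P u j - u j))
    have h6 := norm_add₃_le (a := eulerScheme P u (j + m + 1) - u (j + m + 1) -
      (eulerScheme P u (j + m) - u (j + m))) (b := u (j + m + 1) - u (j + m))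
      (c := eulerScheme P u (j + m) - eulerScheme P u j)
    rw [sub_add_sub_cancel] at h5
    rw [show eulerScheme P u (j + m + 1) - u (j + m + 1) -
      (eulerScheme P u (j + m) - u (j + m)) + (u (j + m + 1) - u (j + m)) +
      (eulerScheme P u (j + m) - eulerScheme P u j) =
      eulerScheme P u (j + m + 1) - eulerScheme P u j by abel] at h6
    push_cast
    constructor <;> linarith

/-- Each correction is a multiple of a normal at the new iterate. By `inner_step_bound`, moving the
base point back to iterate j costs at most (2RC₀ + 1) · 2kc · c at the k-th step, and these costs
add up to at most the quadratic term. -/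
theorem eulerScheme_variational (hP : ∀ z, P z ∈ closure O)
    (hP' : ∀ z, ∀ y ∈ closure O, ‖P z - z‖ ≤ ‖y - z‖) (hu : u 0 ∈ closure O)
    (hc : ∀ k < n, ‖u (k + 1) - u k‖ ≤ c) (hC₀ : 0 ≤ C₀)
    (hball : ∀ x ∈ closure O, ∀ v ∈ inwardNormals O x, ∀ z ∈ closure O,
      0 ≤ inner ℝ (z - x) v + C₀ * ‖z - x‖ ^ 2)
    (hR : ∀ x ∈ closure O, ∀ z ∈ closure O, ‖z - x‖ ≤ R) {z : EuclideanSpace ℝ (Fin d)}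
    (hz : z ∈ closure O) (j m : ℕ) (hm : j + m ≤ n) :
    0 ≤ inner ℝ (z - eulerScheme P u j)
        ((eulerScheme P u (j + m) - u (j + m)) - (eulerScheme P u j - u j)) +
      C₀ * (m * c) * ‖z - eulerScheme P u j‖ ^ 2 + 2 * (2 * R * C₀ + 1) * (m * c) ^ 2 := by
  have hmem := eulerScheme_mem hP hu
  have hR0 : 0 ≤ R := (norm_nonneg _).trans (hR z hz z hz)
  induction m with
  | zero => simp
  | succ m ih =>
    have h1 := ih (by omega)
    have h3 := norm_eulerScheme_increment hP hP' hu hc (k := j + m) (by omega)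
    have h4 := (norm_eulerScheme_sub_le hP hP' hu hc j (m + 1) (by omega)).2
    rw [← add_assoc] at h4 ⊢
    set Λ := (eulerScheme P u (j + m + 1) - u (j + m + 1)) -
      (eulerScheme P u (j + m) - u (j + m)) with hΛ
    have hΛ' : Λ = eulerScheme P u (j + m + 1) -
        (eulerScheme P u (j + m) + (u (j + m + 1) - u (j + m))) := by rw [hΛ]; abel
    have h5 : 0 ≤ inner ℝ (z - eulerScheme P u (j + m + 1)) Λ +
        C₀ * ‖Λ‖ * ‖z - eulerScheme P u (j + m + 1)‖ ^ 2 := by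
      refine inner_add_mul_norm_nonneg_of_eq_zero_or_mem
        (fun v hv => hball _ (hmem _) v hv z hz) ?_
      rw [hΛ']
      exact eq_zero_or_mem_inwardNormals_of_nearest (hP' _)
    have h6 := inner_step_bound hC₀ h3 (hR _ (hmem j) z hz) (hR _ (hmem (j + m + 1)) z hz) h4 h5
    have e : inner ℝ (z - eulerScheme P u j)
        ((eulerScheme P u (j + m + 1) - u (j + m + 1)) - (eulerScheme P u j - u j)) =
        inner ℝ (z - eulerScheme P u j)
          ((eulerScheme P u (j + m) - u (j + m)) - (eulerScheme P u j - u j)) +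
        inner ℝ (z - eulerScheme P u j) Λ := by
      rw [← inner_add_right, hΛ]; congr 1; abel
    rw [e]
    push_cast at h6 ⊢
    have h7 : 0 ≤ (2 * R * C₀ + 1) * (m * c ^ 2) := by positivity
    nlinarith

end Euler

/-- Solvability of the reflection problem for Lipschitz inputs, as a limit of projected Euler
schemes. -/
theorem IsAdmissible.exists_reflectsLipschitz (h : IsAdmissible O) (hO : IsOpen O)
    (hb : Bornology.IsBounded O) {f : ℝ≥0 → EuclideanSpace ℝ (Fin d)}
    (hf : LipschitzOnBounded f) (hf0 : f 0 ∈ closure O) :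
    ∃ x ℓ : ℝ≥0 → EuclideanSpace ℝ (Fin d), (∀ t, x t ∈ closure O) ∧ (∀ t, x t = f t + ℓ t) ∧
      ℓ 0 = 0 ∧ ReflectsLipschitz O x ℓ := by
  obtain ⟨C₀, hC₀, hball⟩ := h.exists_uniform_ball hO
  have hcomp : IsCompact (closure O) := hb.isCompact_closure
  obtain ⟨P, hP, hP'⟩ := exists_projection hcomp ⟨_, hf0⟩
  obtain ⟨R, hR⟩ : ∃ R : ℝ, ∀ x ∈ closure O, ∀ z ∈ closure O, ‖z - x‖ ≤ R := by
    obtain ⟨R, hR⟩ := Metric.isBounded_iff.1 hcomp.isBounded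
    exact ⟨R, fun x hx z hz => by rw [← dist_eq_norm]; exact hR hz hx⟩
  have hR0 : 0 ≤ R := (norm_nonneg _).trans (hR _ hf0 _ hf0)
  -- the discretisation with step `1 / (n + 1)`
  let τ : ℕ → ℕ → ℝ≥0 := fun n k => k / (n + 1)
  let u : ℕ → ℕ → EuclideanSpace ℝ (Fin d) := fun n k => f (τ n k)
  let κ : ℕ → ℝ≥0 → ℕ := fun n t => ⌊t * (n + 1)⌋₊
  let X : ℕ → ℝ≥0 → EuclideanSpace ℝ (Fin d) := fun n t => eulerScheme P (u n) (κ n t)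
  have hu0 : ∀ n, u n 0 ∈ closure O := fun n => by simpa [u, τ] using hf0
  have hXmem : ∀ n t, X n t ∈ closure O := fun n t => eulerScheme_mem hP (hu0 n) _
  have hτκ : ∀ n t, τ n (κ n t) ≤ t := fun n t => by
    rw [div_le_iff₀ (by positivity)]
    exact Nat.floor_le (by positivity)
  have hτκ' : ∀ (n : ℕ) (t : ℝ≥0), (t : ℝ) ≤ τ n (κ n t) + 1 / (n + 1) := fun n t => by
    have h1 : t * (n + 1) ≤ κ n t + 1 := (Nat.lt_floor_add_one _).le
    have h2 : (t : ℝ) * (n + 1) ≤ κ n t + 1 := by exact_mod_cast h1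
    simp only [τ, NNReal.coe_div, NNReal.coe_natCast, NNReal.coe_add, NNReal.coe_one]
    rw [← add_div, le_div_iff₀ (by positivity)]
    exact h2
  have hτlim : ∀ t, Tendsto (fun n => τ n (κ n t)) atTop (𝓝 t) := fun t => by
    rw [← NNReal.tendsto_coe]
    refine tendsto_of_tendsto_of_tendsto_of_le_of_le (g := fun n : ℕ => (t : ℝ) - 1 / (n + 1))
      (h := fun _ => (t : ℝ)) ?_ tendsto_const_nhds (fun n => ?_) (fun n => ?_)
    · simpa using (tendsto_const_nhds (x := (t : ℝ))).sub
        (tendsto_one_div_add_atTop_nhds_zero_nat (𝕜 := ℝ))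
    · have := hτκ' n t
      simp only; linarith
    · exact_mod_cast hτκ n t
  have hulim : ∀ t, Tendsto (fun n => u n (κ n t)) (hyperfilter ℕ : Filter ℕ) (𝓝 (f t)) := by
    intro t
    obtain ⟨C, hC⟩ := hf (t + 1)
    have hcont : ContinuousAt f t :=
      hC.continuousOn.continuousAt (Iic_mem_nhds (lt_add_one t))
    exact (hcont.tendsto.comp (hτlim t)).mono_left Nat.hyperfilter_le_atTop
  -- A limit along one fixed ultrafilter exists at every time simultaneously, by compactness alone;
  -- no subsequence or equicontinuity is needed, and the inequalities pass to the limit.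
  have hlim : ∀ t, ∃ y ∈ closure O,
      Tendsto (fun n => X n t) (hyperfilter ℕ : Filter ℕ) (𝓝 y) := fun t => by
    obtain ⟨y, hy, hle⟩ := hcomp.ultrafilter_le_nhds ((hyperfilter ℕ).map (fun n : ℕ => X n t))
      (by
        rw [le_principal_iff, Ultrafilter.coe_map, mem_map]
        exact univ_mem' fun n => hXmem n t)
    exact ⟨y, hy, hle⟩
  choose x hx hxlim using hlim
  refine ⟨x, fun t => x t - f t, hx, fun t => (add_sub_cancel _ _).symm, ?_, fun T => ?_⟩
  · have h1 : ∀ n, X n 0 = f 0 := fun n => by simp [X, κ, u, τ, eulerScheme]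
    have h2 := hxlim 0
    simp_rw [h1] at h2
    exact sub_eq_zero.2 (tendsto_nhds_unique h2 tendsto_const_nhds)
  obtain ⟨C, hC⟩ := hf T
  set M : ℝ := 2 * (2 * R * C₀ + 1) * C ^ 2 with hM
  have hM0 : 0 ≤ M := by positivity
  have hllim : ∀ t, Tendsto (fun n => X n t - u n (κ n t)) (hyperfilter ℕ : Filter ℕ)
      (𝓝 (x t - f t)) := fun t => (hxlim t).sub (hulim t)
  -- the discrete estimates
  have hdisc : ∀ n s t, s ≤ t → t ≤ T →
      ‖(X n t - u n (κ n t)) - (X n s - u n (κ n s))‖ ≤ C * (((t : ℝ) - s) + 1 / (n + 1)) ∧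
      ∀ z ∈ closure O, 0 ≤ inner ℝ (z - X n s) ((X n t - u n (κ n t)) - (X n s - u n (κ n s))) +
        C₀ * (C * (((t : ℝ) - s) + 1 / (n + 1))) * ‖z - X n s‖ ^ 2 +
          M * (((t : ℝ) - s) + 1 / (n + 1)) ^ 2 := by
    intro n s t hst htT
    have hκ : κ n s ≤ κ n t := Nat.floor_mono (by gcongr)
    obtain ⟨m, hm⟩ := Nat.exists_eq_add_of_le hκ
    have hn1 : (0 : ℝ) < n + 1 := by positivity
    -- There are m grid steps between the rounded times; rounding s down accounts for the additional
    -- 1 / (n + 1).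
    have hmc : (m : ℝ) * (C * (1 / (n + 1))) ≤ C * (((t : ℝ) - s) + 1 / (n + 1)) := by
      have h1 := hτκ' n s
      have h2 : (τ n (κ n t) : ℝ) ≤ t := by exact_mod_cast hτκ n t
      rw [hm] at h2
      have h3 : (m : ℝ) * (1 / (n + 1)) = τ n (κ n s + m) - τ n (κ n s) := by
        simp only [τ]; push_cast; ring
      calc (m : ℝ) * (C * (1 / (n + 1))) = C * (m * (1 / (n + 1))) := by ring
        _ ≤ _ := by
          rw [h3]
          exact mul_le_mul_of_nonneg_left (by linarith) C.2
    have hinc : ∀ k < κ n t, ‖u n (k + 1) - u n k‖ ≤ C * (1 / (n + 1)) := fun k hk => by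
      have hle : ∀ k ≤ κ n t, τ n k ∈ Iic T := fun k hk =>
        (show τ n k ≤ τ n (κ n t) by simp only [τ]; gcongr).trans ((hτκ n t).trans htT)
      have := hC.dist_le_mul _ (hle (k + 1) hk) _ (hle k hk.le)
      rw [dist_eq_norm, NNReal.dist_eq] at this
      refine this.trans (mul_le_mul_of_nonneg_left (le_of_eq ?_) C.2)
      simp only [τ]
      push_cast
      rw [← sub_div, add_sub_cancel_left, abs_of_pos (by positivity)]
    have hc0 : 0 ≤ (C : ℝ) * (1 / (n + 1)) := by positivity
    have hmc0 : 0 ≤ (m : ℝ) * (C * (1 / (n + 1))) := by positivity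
    refine ⟨?_, fun z hz => ?_⟩
    · have := (norm_eulerScheme_sub_le hP hP' (hu0 n) hinc (κ n s) m hm.ge).1
      rw [← hm] at this
      exact this.trans hmc
    · have := eulerScheme_variational hP hP' (hu0 n) hinc hC₀ hball hR hz (κ n s) m hm.ge
      rw [← hm] at this
      have h4 := pow_le_pow_left₀ hmc0 hmc 2
      have h5 : 2 * (2 * R * C₀ + 1) * ((m : ℝ) * (C * (1 / (n + 1)))) ^ 2 ≤
          M * (((t : ℝ) - s) + 1 / (n + 1)) ^ 2 := by
        refine (mul_le_mul_of_nonneg_left h4 (by positivity)).trans_eq ?_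
        rw [hM]; ring
      have h6 : C₀ * ((m : ℝ) * (C * (1 / (n + 1)))) * ‖z - X n s‖ ^ 2 ≤
          C₀ * (C * (((t : ℝ) - s) + 1 / (n + 1))) * ‖z - X n s‖ ^ 2 := by gcongr
      exact this.trans (add_le_add (add_le_add le_rfl h6) h5)
  have hεlim : ∀ a : ℝ, Tendsto (fun n : ℕ => a + 1 / ((n : ℝ) + 1)) (hyperfilter ℕ : Filter ℕ)
      (𝓝 a) := fun a => by
    simpa using ((tendsto_const_nhds (x := a)).add
      (tendsto_one_div_add_atTop_nhds_zero_nat (𝕜 := ℝ))).mono_left Nat.hyperfilter_le_atTop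
  set C' : ℝ≥0 := C + Real.toNNReal (C₀ * C) + M.toNNReal with hC'
  have hC'1 : (C : ℝ) ≤ C' := by
    rw [hC']; push_cast; linarith [(Real.toNNReal (C₀ * C)).2, M.toNNReal.2]
  have hC'2 : C₀ * C ≤ C' := by
    rw [hC']; push_cast; linarith [Real.le_coe_toNNReal (C₀ * C), M.toNNReal.2, C.2]
  have hC'3 : M ≤ C' := by
    rw [hC']; push_cast; linarith [Real.le_coe_toNNReal M, (Real.toNNReal (C₀ * C)).2, C.2]
  have hlip : ∀ s t, s ≤ t → t ≤ T → ‖(x t - f t) - (x s - f s)‖ ≤ C' * ((t : ℝ) - s) := by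
    intro s t hst htT
    have h1 := le_of_tendsto_of_tendsto ((hllim t).sub (hllim s)).norm
      ((tendsto_const_nhds (x := (C : ℝ))).mul (hεlim ((t : ℝ) - s)))
      (Eventually.of_forall fun n => (hdisc n s t hst htT).1)
    have h2 : (0 : ℝ) ≤ (t : ℝ) - s := sub_nonneg.2 (by exact_mod_cast hst)
    exact h1.trans (by gcongr)
  refine ⟨C', LipschitzOnWith.of_dist_le_mul fun a ha b hb => ?_, fun s t hst htT z hz => ?_⟩
  · rw [dist_eq_norm, NNReal.dist_eq]
    rcases le_total a b with hab | hab
    · rw [norm_sub_rev, abs_sub_comm, abs_of_nonneg (sub_nonneg.2 (by exact_mod_cast hab))]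
      exact hlip a b hab hb
    · rw [abs_of_nonneg (sub_nonneg.2 (by exact_mod_cast hab))]
      exact hlip b a hab ha
  · have h2 : (0 : ℝ) ≤ (t : ℝ) - s := sub_nonneg.2 (by exact_mod_cast hst)
    have hz1 : Tendsto (fun n => z - X n s) (hyperfilter ℕ : Filter ℕ) (𝓝 (z - x s)) :=
      tendsto_const_nhds.sub (hxlim s)
    have h1 := ge_of_tendsto (((hz1.inner ((hllim t).sub (hllim s))).add
      (((tendsto_const_nhds (x := C₀)).mul ((tendsto_const_nhds (x := (C : ℝ))).mul
        (hεlim ((t : ℝ) - s)))).mul (hz1.norm.pow 2))).add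
      ((tendsto_const_nhds (x := M)).mul ((hεlim ((t : ℝ) - s)).pow 2)))
      (Eventually.of_forall fun n => (hdisc n s t hst htT).2 z hz)
    refine h1.trans (add_le_add (add_le_add le_rfl ?_) (by gcongr))
    rw [← mul_assoc C₀]
    gcongr

end ReflectedODE

/-! ### Total variation as a measure, and its density for Lipschitz paths. -/

namespace ReflectedODE

section TotalVariation

variable {E : Type*} [NormedAddCommGroup E] (ℓ : C(ℝ≥0, E)) (h : LocallyBoundedVariationOn ℓ univ)

theorem totalVariation_apply (t : ℝ≥0) :
    totalVariation ℓ h t = variationOnFromTo ℓ univ 0 t := rfl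

theorem totalVariation_zero : totalVariation ℓ h 0 = 0 :=
  variationOnFromTo.self _ _ _

theorem totalVariation_sub {s t : ℝ≥0} (hst : s ≤ t) :
    totalVariation ℓ h t - totalVariation ℓ h s = (eVariationOn ℓ (Icc s t)).toReal := by
  rw [totalVariation_apply, totalVariation_apply,
    variationOnFromTo.sub_right h (mem_univ _) (mem_univ _) (mem_univ _),
    variationOnFromTo.eq_of_le _ _ hst, univ_inter]

theorem eVariationOn_Icc_eq_ofReal {s t : ℝ≥0} (hst : s ≤ t) :
    eVariationOn ℓ (Icc s t) = ENNReal.ofReal (totalVariation ℓ h t - totalVariation ℓ h s) := by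
  rw [totalVariation_sub ℓ h hst, ENNReal.ofReal_toReal]
  have := h s t (mem_univ _) (mem_univ _)
  rwa [univ_inter] at this

theorem norm_sub_le_totalVariation_sub {s t : ℝ≥0} (hst : s ≤ t) :
    ‖ℓ t - ℓ s‖ ≤ totalVariation ℓ h t - totalVariation ℓ h s := by
  have h1 := eVariationOn.edist_le ℓ (right_mem_Icc.2 hst) (left_mem_Icc.2 hst)
  rw [eVariationOn_Icc_eq_ofReal ℓ h hst, edist_dist, dist_eq_norm] at h1
  exact (ENNReal.ofReal_le_ofReal_iff (sub_nonneg.2 ((totalVariation ℓ h).mono hst))).1 h1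

/-- Continuity means that d|ℓ| has no atoms, and it later allows the clock t + |ℓ|_t to be inverted.
-/
theorem continuous_totalVariation : Continuous (totalVariation ℓ h) := by
  refine continuous_iff_continuousAt.2 fun t => continuousAt_iff_continuous_left_right.2
    ⟨?_, (totalVariation ℓ h).right_continuous t⟩
  have key := variationOnFromTo.tendsto_left (s := univ) (l := ℓ t) (mem_univ (0 : ℝ≥0))
    (mem_univ t) h (by simpa using (ℓ.continuous.tendsto t).mono_left nhdsWithin_le_nhds)
  rw [← continuousWithinAt_Iio_iff_Iic, ContinuousWithinAt, totalVariation_apply]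
  rw [univ_inter, dist_self, sub_zero] at key
  exact key

theorem variationMeasure_Icc (s t : ℝ≥0) : variationMeasure ℓ h (Icc s t) =
    ENNReal.ofReal (totalVariation ℓ h t - totalVariation ℓ h s) := by
  rw [variationMeasure, StieltjesFunction.measure_Icc,
    (continuous_totalVariation ℓ h).continuousWithinAt.leftLim_eq]

theorem variationMeasure_Ioc (s t : ℝ≥0) : variationMeasure ℓ h (Ioc s t) =
    ENNReal.ofReal (totalVariation ℓ h t - totalVariation ℓ h s) :=
  StieltjesFunction.measure_Ioc _ _ _

end TotalVariation

theorem LipschitzOnBounded.locallyBoundedVariationOn {E : Type*} [NormedAddCommGroup E]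
    {f : ℝ≥0 → E} (hf : LipschitzOnBounded f) :
    LocallyBoundedVariationOn f univ := by
  intro a b _ _
  obtain ⟨C, hC⟩ := hf b
  have h1 := (lipschitzOnWith_comp_toNNReal hC).comp_eVariationOn_le
    (g := ((↑) : ℝ≥0 → ℝ)) (s := Icc a b) (fun s hs => NNReal.coe_le_coe.2 hs.2)
  have h2 := (NNReal.coe_mono.monotoneOn univ).locallyBoundedVariationOn a b
    (mem_univ _) (mem_univ _)
  rw [univ_inter] at h2 ⊢
  have e : (fun s : ℝ => f s.toNNReal) ∘ ((↑) : ℝ≥0 → ℝ) = f := by ext; simp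
  rw [e] at h1
  exact ne_top_of_le_ne_top (ENNReal.mul_ne_top ENNReal.coe_ne_top h2) h1

theorem LipschitzOnWith.norm_deriv_toNNReal_le {E : Type*} [NormedAddCommGroup E] [NormedSpace ℝ E]
    {f : ℝ≥0 → E} {C T : ℝ≥0}
    (hC : LipschitzOnWith C f (Iic T)) {s : ℝ} (hs : s < T) :
    ‖deriv (fun s : ℝ => f s.toNNReal) s‖ ≤ C :=
  norm_deriv_le_of_lipschitzOn (Iic_mem_nhds hs) (lipschitzOnWith_comp_toNNReal hC)

section Lipschitz

variable {E : Type*} [NormedAddCommGroup E] [InnerProductSpace ℝ E] [FiniteDimensional ℝ E]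

theorem LipschitzOnBounded.intervalIntegrable_deriv {f : ℝ≥0 → E} (hf : LipschitzOnBounded f)
    (a b : ℝ) : IntervalIntegrable (deriv (fun s : ℝ => f s.toNNReal)) volume a b := by
  borelize E
  obtain ⟨C, hC⟩ := hf ((max a b).toNNReal + 1)
  refine (intervalIntegrable_const (c := (C : ℝ))).mono_fun
    (stronglyMeasurable_deriv _).aestronglyMeasurable ?_
  refine (ae_restrict_iff' measurableSet_uIoc).2 (ae_of_all _ fun s hs => ?_)
  refine le_trans (LipschitzOnWith.norm_deriv_toNNReal_le hC ?_) (le_abs_self _)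
  push_cast
  exact (hs.2.trans (Real.le_coe_toNNReal _)).trans_lt (lt_add_one _)

/-- Pairing with a fixed vector reduces this to the fundamental theorem for real absolutely
continuous functions. -/
theorem LipschitzOnBounded.integral_deriv {f : ℝ≥0 → E} (hf : LipschitzOnBounded f)
    {a b : ℝ} : ∫ s in a..b, deriv (fun s : ℝ => f s.toNNReal) s = f b.toNNReal - f a.toNNReal := by
  have : CompleteSpace E := FiniteDimensional.complete ℝ E
  refine ext_inner_left ℝ fun v => ?_
  obtain ⟨C, hC⟩ := hf (max a b).toNNReal
  have hL : LipschitzOnWith (‖innerSL ℝ v‖₊ * C) (fun t => inner ℝ v (f t))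
      (Iic (max a b).toNNReal) :=
    (innerSL ℝ v).lipschitz.comp_lipschitzOnWith hC
  have hac := LipschitzOnWith.absolutelyContinuous_toNNReal hL
    ((le_max_left a b).trans (Real.le_coe_toNNReal _))
    ((le_max_right a b).trans (Real.le_coe_toNNReal _))
  have h1 := (innerSL ℝ v).intervalIntegral_comp_comm (hf.intervalIntegrable_deriv a b)
  simp only [innerSL_apply_apply] at h1
  rw [← h1, inner_sub_right, ← hac.integral_deriv_eq_sub]
  refine intervalIntegral.integral_congr_ae ?_
  filter_upwards [hf.ae_differentiableAt] with s hs _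
  exact (((innerSL ℝ v).hasFDerivAt.comp_hasDerivAt s hs.hasDerivAt).deriv).symm

/-- The total variation of a Lipschitz path is the integral of its speed. -/
theorem totalVariation_sub_eq_integral (ℓ : C(ℝ≥0, E)) (h : LocallyBoundedVariationOn ℓ univ)
    (hℓ : LipschitzOnBounded ℓ) {s t : ℝ≥0} (hst : s ≤ t) :
    totalVariation ℓ h t - totalVariation ℓ h s =
      ∫ u in (s : ℝ)..t, ‖deriv (fun s : ℝ => ℓ s.toNNReal) u‖ := by
  set g : ℝ → ℝ := fun u => ‖deriv (fun s : ℝ => ℓ s.toNNReal) u‖ with hg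
  have hgi : ∀ a b, IntervalIntegrable g volume a b :=
    fun a b => (hℓ.intervalIntegrable_deriv a b).norm
  let G : ℝ≥0 → ℝ := fun t => ∫ u in (0 : ℝ)..t, g u
  have hG : ∀ s t, G t - G s = ∫ u in (s : ℝ)..t, g u := fun s t =>
    intervalIntegral.integral_interval_sub_left (hgi _ _) (hgi _ _)
  have hle : ∀ s t, s ≤ t → ‖ℓ t - ℓ s‖ ≤ G t - G s := fun s t hst => by
    have := hℓ.integral_deriv (a := s) (b := t)
    rw [Real.toNNReal_coe, Real.toNNReal_coe] at this
    rw [hG, ← this]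
    exact intervalIntegral.norm_integral_le_integral_norm (by exact_mod_cast hst)
  have hGm : Monotone G := fun s t hst => sub_nonneg.1 ((norm_nonneg _).trans (hle s t hst))
  -- The increments of ℓ are dominated by those of the monotone function G, whose variation is its
  -- increment.
  have hup : ∀ s t, s ≤ t → totalVariation ℓ h t - totalVariation ℓ h s ≤ G t - G s := by
    intro s t hst
    rw [← ENNReal.ofReal_le_ofReal_iff (sub_nonneg.2 (hGm hst)), ← eVariationOn_Icc_eq_ofReal ℓ h hst]
    have h1 : eVariationOn ℓ (Icc s t) ≤ eVariationOn G (univ ∩ Icc s t) := by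
      rw [univ_inter]
      refine iSup_mono fun p => Finset.sum_le_sum fun i _ => ?_
      have hm := p.2.2.1 (Nat.le_succ i)
      rw [edist_dist, edist_dist, dist_eq_norm, Real.dist_eq]
      exact ENNReal.ofReal_le_ofReal ((hle _ _ hm).trans (le_abs_self _))
    refine h1.trans_eq ?_
    exact (hGm.monotoneOn univ).eVariationOn_eq (mem_univ _) (mem_univ _)
  refine le_antisymm ((hup s t hst).trans_eq (hG s t)) ?_
  -- The upper bound makes |ℓ| Lipschitz, hence the integral of its derivative. The reverse
  -- inequality then follows by comparing difference quotients of ℓ and |ℓ|.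
  have hVL : LipschitzOnBounded (totalVariation ℓ h) := fun T => by
    obtain ⟨C, hC⟩ := hℓ (T + 1)
    have hb : ∀ a b : ℝ≥0, a ≤ b → b ≤ T →
        totalVariation ℓ h b - totalVariation ℓ h a ≤ C * ((b : ℝ) - a) := fun a b hab hb => by
      refine (hup a b hab).trans ?_
      rw [hG]
      have := intervalIntegral.norm_integral_le_of_norm_le_const (a := (a : ℝ)) (b := b) (f := g)
        (C := C) (fun u hu => by
          rw [hg, norm_norm]
          refine LipschitzOnWith.norm_deriv_toNNReal_le hC ?_
          rw [uIoc_of_le (by exact_mod_cast hab)] at hu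
          have hb' : (b : ℝ) ≤ T := by exact_mod_cast hb
          push_cast
          linarith [hu.2])
      rw [abs_of_nonneg (sub_nonneg.2 (by exact_mod_cast hab))] at this
      exact (le_abs_self _).trans this
    refine ⟨C, LipschitzOnWith.of_dist_le_mul fun a ha b hb' => ?_⟩
    rw [Real.dist_eq, NNReal.dist_eq]
    rcases le_total a b with hab | hab
    · rw [abs_sub_comm, abs_sub_comm (a : ℝ), abs_of_nonneg (sub_nonneg.2 (NNReal.coe_le_coe.2 hab)),
        abs_of_nonneg (sub_nonneg.2 ((totalVariation ℓ h).mono hab))]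
      exact hb a b hab hb'
    · rw [abs_of_nonneg (sub_nonneg.2 (NNReal.coe_le_coe.2 hab)),
        abs_of_nonneg (sub_nonneg.2 ((totalVariation ℓ h).mono hab))]
      exact hb b a hab ha
  have hV := hVL.integral_deriv (a := s) (b := t)
  rw [Real.toNNReal_coe, Real.toNNReal_coe] at hV
  rw [← hV]
  refine intervalIntegral.integral_mono_ae_restrict (by exact_mod_cast hst) (hgi _ _)
    (hVL.intervalIntegrable_deriv _ _) ?_
  rw [← restrict_Ioo_eq_restrict_Icc]
  refine (ae_restrict_iff' measurableSet_Ioo).2 ?_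
  filter_upwards [hℓ.ae_differentiableAt, hVL.ae_differentiableAt] with u h1 h2 hu
  have hu0 : 0 ≤ u := s.2.trans hu.1.le
  have hl1 := ((hasDerivWithinAt_iff_tendsto_slope' (notMem_Ioi.2 le_rfl)).1
    (h1.hasDerivAt.hasDerivWithinAt (s := Ioi u))).norm
  have hl2 := (hasDerivWithinAt_iff_tendsto_slope' (notMem_Ioi.2 le_rfl)).1
    (h2.hasDerivAt.hasDerivWithinAt (s := Ioi u))
  refine le_of_tendsto_of_tendsto hl1 hl2 ?_
  filter_upwards [self_mem_nhdsWithin] with r hr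
  have hr' : 0 < r - u := sub_pos.2 hr
  rw [slope_def_module, slope_def_module, norm_smul, smul_eq_mul,
    Real.norm_of_nonneg (inv_nonneg.2 hr'.le)]
  exact mul_le_mul_of_nonneg_left
    (norm_sub_le_totalVariation_sub ℓ h (Real.toNNReal_le_toNNReal (le_of_lt hr)))
    (inv_nonneg.2 hr'.le)

/-- The variation measure of a Lipschitz path has its speed as density. -/
theorem variationMeasure_eq_withDensity (ℓ : C(ℝ≥0, E)) (h : LocallyBoundedVariationOn ℓ univ)
    (hℓ : LipschitzOnBounded ℓ) :
    variationMeasure ℓ h = (Measure.comap ((↑) : ℝ≥0 → ℝ) volume).withDensity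
      fun u => (‖deriv (fun s : ℝ => ℓ s.toNNReal) (u : ℝ)‖₊ : ℝ≥0∞) := by
  refine Measure.ext_of_Icc' _ _ (fun a b _ => ?_) (fun a b hab => ?_)
  · rw [variationMeasure_Icc]
    exact ENNReal.ofReal_ne_top
  have hab' : (a : ℝ) ≤ b := by exact_mod_cast hab
  have himg : ((↑) : ℝ≥0 → ℝ) '' Icc a b = Icc (a : ℝ) b := by
    ext r
    constructor
    · rintro ⟨s, hs, rfl⟩
      exact ⟨NNReal.coe_le_coe.2 hs.1, NNReal.coe_le_coe.2 hs.2⟩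
    · exact fun hr => ⟨⟨r, a.2.trans hr.1⟩, ⟨NNReal.coe_le_coe.1 hr.1, NNReal.coe_le_coe.1 hr.2⟩, rfl⟩
  rw [variationMeasure_Icc, totalVariation_sub_eq_integral ℓ h hℓ hab,
    withDensity_apply _ measurableSet_Icc, intervalIntegral.integral_of_le hab',
    ← integral_Icc_eq_integral_Ioc, ofReal_integral_norm_eq_lintegral_enorm, ← himg]
  · exact (setLIntegral_subtype measurableSet_Ici _ _).symm
  · exact ((intervalIntegrable_iff_integrableOn_Icc_of_le hab').1
      (hℓ.intervalIntegrable_deriv _ _))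

end Lipschitz

end ReflectedODE

/-! ### Lipschitz reflection terms solve the Skorohod problem; uniqueness by change of time. -/

namespace ReflectedODE

variable {d : ℕ} {O : Set (EuclideanSpace ℝ (Fin d))}

theorem ReflectsLipschitz.isReflectionTerm (hO : IsOpen O) {x : C(ℝ≥0, closure O)}
    {ℓ : C(ℝ≥0, EuclideanSpace ℝ (Fin d))} (hR : ReflectsLipschitz O (fun t => x t) ℓ)
    (h0 : ℓ 0 = 0) : IsReflectionTerm O x ℓ := by
  have hL := hR.lipschitzOnBounded
  have h := hL.locallyBoundedVariationOn
  set D : ℝ → EuclideanSpace ℝ (Fin d) := deriv (fun s : ℝ => ℓ s.toNNReal) with hD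
  have hDm : Measurable D := measurable_deriv _
  have hμ := variationMeasure_eq_withDensity ℓ h hL
  have hνm : Measurable fun u : ℝ≥0 => ‖D u‖₊ := (hDm.comp measurable_subtype_coe).nnnorm
  have hemb : MeasurableEmbedding ((↑) : ℝ≥0 → ℝ) :=
    MeasurableEmbedding.subtype_coe measurableSet_Ici
  -- The times with D = 0 are null for d|ℓ|, whose density is ‖D‖; time 0 is a Lebesgue null set,
  -- discarded because the derivative there is not controlled.
  have hn : ∀ᵐ s ∂variationMeasure ℓ h, ‖D s‖⁻¹ • D s ∈ inwardNormals O (x s) := by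
    rw [hμ, ae_withDensity_iff (by fun_prop)]
    have hR' : ∀ᵐ s : ℝ, 0 < s → (D s = 0 ∨ ‖D s‖⁻¹ • D s ∈ inwardNormals O (x s.toNNReal)) := by
      filter_upwards [hL.ae_differentiableAt] with s hs hs0
      exact hR.deriv_eq_zero_or_mem hs0 hs
    have hR'' : ∀ᵐ s : ℝ, s ≠ 0 := by
      simp [ae_iff]
    rw [ae_iff, hemb.comap_apply]
    refine measure_mono_null ?_ (ae_iff.1 (hR'.and hR''))
    rintro _ ⟨s, hs, rfl⟩ hcon
    refine hs fun hne => ?_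
    have h3 := hcon.1 (lt_of_le_of_ne s.2 (Ne.symm hcon.2))
    rw [Real.toNNReal_coe] at h3
    refine h3.resolve_left fun h4 => hne ?_
    change ((‖D s‖₊ : ℝ≥0) : ℝ≥0∞) = 0
    rw [h4]; simp
  refine ⟨h, fun t => ?_, fun s => ‖D s‖⁻¹ • D s, ?_, hn, fun t => ?_⟩
  -- The indicator is 1 almost everywhere: a point with a normal lies on the frontier.
  · rw [eVariationOn_Icc_eq_ofReal ℓ h zero_le, ← variationMeasure_Icc ℓ h, ← setLIntegral_one]
    refine lintegral_congr_ae (ae_restrict_of_ae ?_)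
    filter_upwards [hn] with s hs
    rw [indicator_of_mem (mem_frontier_of_mem_inwardNormals hO (x s).2 hs)]
    rfl
  · exact ((hDm.norm.inv.smul hDm).comp measurable_subtype_coe).aestronglyMeasurable
  · have hint := hL.integral_deriv (a := (0 : ℝ)) (b := t)
    rw [Real.toNNReal_coe, Real.toNNReal_zero, h0, sub_zero] at hint
    have himg : ((↑) : ℝ≥0 → ℝ) '' Icc 0 t = Icc (0 : ℝ) t := by
      ext r
      constructor
      · rintro ⟨s, hs, rfl⟩
        exact ⟨s.2, NNReal.coe_le_coe.2 hs.2⟩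
      · exact fun hr => ⟨⟨r, hr.1⟩, ⟨zero_le, NNReal.coe_le_coe.1 hr.2⟩, rfl⟩
    rw [← hint, hμ, restrict_withDensity measurableSet_Icc,
      integral_withDensity_eq_integral_smul hνm, intervalIntegral.integral_of_le t.coe_nonneg,
      ← integral_Icc_eq_integral_Ioc, ← himg]
    have h1 : ∀ s : ℝ≥0, ‖D s‖₊ • ‖D s‖⁻¹ • D s = D s := fun s => by
      rcases eq_or_ne (D s) 0 with h2 | h2
      · simp [h2]
      · rw [NNReal.smul_def, coe_nnnorm, smul_smul, mul_inv_cancel₀ (norm_ne_zero_iff.2 h2),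
          one_smul]
    simp_rw [h1]
    rw [hemb.restrict_comap, ← hemb.integral_map, hemb.map_comap, Measure.restrict_restrict
      hemb.measurableSet_range, inter_eq_right.2 (image_subset_range _ _)]

/-- Change of the time scale by a nondecreasing `1`-Lipschitz function. -/
theorem ReflectsLipschitz.comp {x ℓ : ℝ≥0 → EuclideanSpace ℝ (Fin d)}
    (hR : ReflectsLipschitz O x ℓ) {θ : ℝ≥0 → ℝ≥0} (hθ : Monotone θ) (hθ1 : LipschitzWith 1 θ)
    (hθ0 : ∀ t, θ t ≤ t) : ReflectsLipschitz O (x ∘ θ) (ℓ ∘ θ) := by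
  intro T
  obtain ⟨C, hC, hC'⟩ := hR T
  refine ⟨C, ?_, fun s t hst htT z hz => ?_⟩
  · have := hC.comp (hθ1.lipschitzOnWith (s := Iic T)) (fun t ht => (hθ0 t).trans ht)
    rwa [mul_one] at this
  · have h1 := hC' _ _ (hθ hst) ((hθ0 t).trans htT) z hz
    have h2 : (0 : ℝ) ≤ (θ t : ℝ) - θ s := sub_nonneg.2 (NNReal.coe_le_coe.2 (hθ hst))
    have h3 : (θ t : ℝ) - θ s ≤ t - s := by
      have := hθ1.dist_le_mul t s
      rw [NNReal.dist_eq, NNReal.dist_eq, abs_of_nonneg h2,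
        abs_of_nonneg (sub_nonneg.2 (NNReal.coe_le_coe.2 hst))] at this
      simpa using this
    have h4 := pow_le_pow_left₀ h2 h3 2
    refine h1.trans (add_le_add (add_le_add le_rfl ?_) ?_)
    · simp only [Function.comp]
      gcongr
    · gcongr

theorem LipschitzOnBounded.comp {E : Type*} [PseudoEMetricSpace E] {f : ℝ≥0 → E}
    (hf : LipschitzOnBounded f) {θ : ℝ≥0 → ℝ≥0} (hθ1 : LipschitzWith 1 θ)
    (hθ0 : ∀ t, θ t ≤ t) : LipschitzOnBounded (f ∘ θ) := by
  intro T
  obtain ⟨C, hC⟩ := hf T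
  have := hC.comp (hθ1.lipschitzOnWith (s := Iic T)) (fun t ht => (hθ0 t).trans ht)
  exact ⟨_, this⟩

theorem lipschitzOnWith_Iic_of_le {E : Type*} [NormedAddCommGroup E] {f : ℝ≥0 → E} {C T : ℝ≥0}
    (h : ∀ s t, s ≤ t → t ≤ T → ‖f t - f s‖ ≤ C * ((t : ℝ) - s)) :
    LipschitzOnWith C f (Iic T) := by
  refine LipschitzOnWith.of_dist_le_mul fun a ha b hb => ?_
  rw [dist_eq_norm, NNReal.dist_eq]
  rcases le_total a b with hab | hab
  · rw [norm_sub_rev, abs_sub_comm, abs_of_nonneg (sub_nonneg.2 (NNReal.coe_le_coe.2 hab))]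
    exact h a b hab hb
  · rw [abs_of_nonneg (sub_nonneg.2 (NNReal.coe_le_coe.2 hab))]
    exact h b a hab ha

/-- The variational inequality over a time interval for a reflection term of bounded variation. -/
theorem IsReflectionTerm.variational_inequality {C₀ R : ℝ} (hC₀ : 0 ≤ C₀)
    (hball : ∀ x ∈ closure O, ∀ v ∈ inwardNormals O x, ∀ z ∈ closure O,
      0 ≤ inner ℝ (z - x) v + C₀ * ‖z - x‖ ^ 2)
    (hR : ∀ x ∈ closure O, ∀ z ∈ closure O, ‖z - x‖ ≤ R) {x : C(ℝ≥0, closure O)}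
    {ℓ : C(ℝ≥0, EuclideanSpace ℝ (Fin d))} (h : LocallyBoundedVariationOn ℓ univ)
    {n : ℝ≥0 → EuclideanSpace ℝ (Fin d)}
    (hnm : AEStronglyMeasurable n (variationMeasure ℓ h))
    (hn : ∀ᵐ s ∂variationMeasure ℓ h, n s ∈ inwardNormals O (x s))
    (hℓ : ∀ t : ℝ≥0, ℓ t = ∫ s in Icc 0 t, n s ∂variationMeasure ℓ h)
    {s t : ℝ≥0} (hst : s ≤ t) {η : ℝ}
    (hη : ∀ u ∈ Icc s t, ‖(x u : EuclideanSpace ℝ (Fin d)) - x s‖ ≤ η)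
    {z : EuclideanSpace ℝ (Fin d)} (hz : z ∈ closure O) :
    0 ≤ inner ℝ (z - x s) (ℓ t - ℓ s) +
      (C₀ * ‖z - x s‖ ^ 2 + (2 * R * C₀ + 1) * η) *
        (totalVariation ℓ h t - totalVariation ℓ h s) := by
  set μ := variationMeasure ℓ h with hμ
  have hfin : μ (Icc 0 t) < ∞ := by
    rw [hμ, variationMeasure_Icc]; exact ENNReal.ofReal_lt_top
  have hint : IntegrableOn n (Icc 0 t) μ := by
    refine Measure.integrableOn_of_bounded (M := 1) hfin.ne hnm ?_
    exact ae_restrict_of_ae (hn.mono fun s hs => hs.1.le)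
  have hsub : Ioc s t ⊆ Icc 0 t := fun u hu => ⟨zero_le, hu.2⟩
  have hdiff : ℓ t - ℓ s = ∫ u in Ioc s t, n u ∂μ := by
    have hu : Icc 0 t = Icc 0 s ∪ Ioc s t := (Icc_union_Ioc_eq_Icc zero_le hst).symm
    rw [hℓ t, hℓ s, hu, setIntegral_union ?_ measurableSet_Ioc
      (hint.mono_set (Icc_subset_Icc le_rfl hst)) (hint.mono_set hsub), add_sub_cancel_left]
    exact Set.disjoint_left.2 fun u h1 h2 => absurd h1.2 (not_le.2 h2.1)
  set A := C₀ * ‖z - x s‖ ^ 2 + (2 * R * C₀ + 1) * η with hA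
  have hV : μ.real (Ioc s t) = totalVariation ℓ h t - totalVariation ℓ h s := by
    rw [Measure.real, hμ, variationMeasure_Ioc,
      ENNReal.toReal_ofReal (sub_nonneg.2 ((totalVariation ℓ h).mono hst))]
  -- The normal n u belongs to the point x u; replacing that base point by x s costs a multiple of
  -- the oscillation η.
  have hlow : ∀ᵐ u ∂μ.restrict (Ioc s t), -A ≤ inner ℝ (z - x s) (n u) := by
    refine (ae_restrict_iff' measurableSet_Ioc).2 (hn.mono fun u hu hus => ?_)
    have h1 := hball _ (x u).2 _ hu z hz
    have h2 := inner_step_bound (x := (x s : EuclideanSpace ℝ (Fin d))) (c := 1) hC₀ hu.1.le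
      (hR _ (x s).2 z hz) (hR _ (x u).2 z hz) (hη u ⟨hus.1.le, hus.2⟩) (by rwa [hu.1, mul_one])
    rw [mul_one, mul_one] at h2
    linarith
  rw [hdiff, ← integral_inner (hint.mono_set hsub), ← hV]
  have hconst : ∫ _ in Ioc s t, -A ∂μ = -A * μ.real (Ioc s t) := by
    rw [setIntegral_const, smul_eq_mul, mul_comm]
  have := integral_mono_ae (μ := μ.restrict (Ioc s t)) (f := fun _ => -A)
    (integrableOn_const (ne_top_of_le_ne_top hfin.ne (measure_mono hsub)))
    ((hint.mono_set hsub).const_inner _) hlow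
  rw [hconst] at this
  linarith

/-- A continuous nondecreasing clock which runs at least as fast as time has an inverse which is
nondecreasing and `1`-Lipschitz. -/
theorem exists_inverse_clock {V : ℝ≥0 → ℝ} (hVc : Continuous V) (hVm : Monotone V) (hV0 : V 0 = 0) :
    ∃ θ : ℝ≥0 → ℝ≥0, Monotone θ ∧ Function.Surjective θ ∧
      ∀ s t, s ≤ t → ((θ t : ℝ) - θ s) + (V (θ t) - V (θ s)) = t - s := by
  have hV : ∀ t, 0 ≤ V t := fun t => hV0 ▸ hVm zero_le
  -- The summand t makes A strictly increasing and unbounded, so it is an order isomorphism even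
  -- where V is constant.
  let A : ℝ≥0 → ℝ≥0 := fun t => ⟨t + V t, add_nonneg t.2 (hV t)⟩
  have hAm : StrictMono A := fun s t hst =>
    NNReal.coe_lt_coe.1 (add_lt_add_of_lt_of_le (NNReal.coe_lt_coe.2 hst) (hVm hst.le))
  have hAc : Continuous A := (NNReal.continuous_coe.add hVc).subtype_mk _
  have hA0 : A 0 = 0 := NNReal.coe_injective (by change (0 : ℝ) + V 0 = 0; rw [hV0, add_zero])
  have hAs : Function.Surjective A := fun u => by
    have hle : u ≤ A u := NNReal.coe_le_coe.1 (le_add_of_nonneg_right (hV u))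
    obtain ⟨t, -, ht⟩ := intermediate_value_Icc (zero_le (a := u)) hAc.continuousOn
      ⟨hA0.trans_le zero_le, hle⟩
    exact ⟨t, ht⟩
  let e := StrictMono.orderIsoOfSurjective A hAm hAs
  refine ⟨e.symm, e.symm.monotone, e.symm.surjective, fun s t _ => ?_⟩
  have hs : A (e.symm s) = s := e.apply_symm_apply s
  have ht : A (e.symm t) = t := e.apply_symm_apply t
  have hs' : ((e.symm s : ℝ≥0) : ℝ) + V (e.symm s) = s := congrArg NNReal.toReal hs
  have ht' : ((e.symm t : ℝ≥0) : ℝ) + V (e.symm t) = t := congrArg NNReal.toReal ht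
  linarith

/-- The comparison with equal inputs, where N = 0 and g = 0. -/
theorem ReflectsLipschitz.unique (h : IsAdmissible O) (hO : IsOpen O)
    (hb : Bornology.IsBounded O) {f x x' ℓ ℓ' : ℝ≥0 → EuclideanSpace ℝ (Fin d)}
    (hx : ∀ t, x t ∈ closure O) (hx' : ∀ t, x' t ∈ closure O)
    (hxf : ∀ t, x t = f t + ℓ t) (hxf' : ∀ t, x' t = f t + ℓ' t) (h0 : x 0 = x' 0)
    (hR : ReflectsLipschitz O x ℓ) (hR' : ReflectsLipschitz O x' ℓ')
    (hf : LipschitzOnBounded f) : x = x' := by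
  ext1 t
  obtain ⟨L, hL⟩ := hf t
  obtain ⟨C, hC⟩ := h.exists_comparison hO hb L 0
  have := hC t f f x x' ℓ ℓ' (fun _ => 0) hx hx' hxf hxf' h0 hR hR' hf hf hL hL
    (fun _ => le_rfl) intervalIntegrable_const (ae_of_all _ fun s _ => by simp)
  simp only [mul_zero, intervalIntegral.integral_zero] at this
  exact sub_eq_zero.1 (norm_eq_zero.1 (pow_eq_zero_iff two_ne_zero |>.1
    (le_antisymm this (sq_nonneg _))))

theorem IsReflectionTerm.zero {x : C(ℝ≥0, closure O)} {ℓ : C(ℝ≥0, EuclideanSpace ℝ (Fin d))}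
    (hℓ : IsReflectionTerm O x ℓ) : ℓ 0 = 0 := by
  obtain ⟨h, -, n, -, -, hn⟩ := hℓ
  rw [hn 0, Measure.restrict_eq_zero.2, integral_zero_measure]
  rw [variationMeasure_Icc, sub_self, ENNReal.ofReal_zero]

/-- Every solution of the Skorohod problem with Lipschitz input is Lipschitz: after a change of
time which makes it Lipschitz, it agrees with the solution constructed from Euler schemes. -/
theorem IsSkorohodSolution.reflectsLipschitz (h : IsAdmissible O) (hO : IsOpen O)
    (hb : Bornology.IsBounded O) {f : ℝ≥0 → EuclideanSpace ℝ (Fin d)} (hf : LipschitzOnBounded f)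
    {x : C(ℝ≥0, closure O)} {ℓ : C(ℝ≥0, EuclideanSpace ℝ (Fin d))}
    (hs : IsSkorohodSolution O f x ℓ) : ReflectsLipschitz O (fun t => x t) ℓ := by
  obtain ⟨hxf, hrefl⟩ := hs
  have hℓ0 := hrefl.zero
  have hf0 : f 0 ∈ closure O := by
    have := hxf 0
    rw [hℓ0, add_zero] at this
    exact this ▸ (x 0).2
  obtain ⟨hbv, -, n, hnm, hn, hℓ⟩ := hrefl
  obtain ⟨x', ℓ', hx', hxf', hℓ0', hR'⟩ := h.exists_reflectsLipschitz hO hb hf hf0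
  obtain ⟨C₀, hC₀, hball⟩ := h.exists_uniform_ball hO
  obtain ⟨R, hR⟩ : ∃ R : ℝ, ∀ x ∈ closure O, ∀ z ∈ closure O, ‖z - x‖ ≤ R := by
    obtain ⟨R, hR⟩ := Metric.isBounded_iff.1 hb.closure
    exact ⟨R, fun x hx z hz => by rw [← dist_eq_norm]; exact hR hz hx⟩
  have hR0 : 0 ≤ R := (norm_nonneg _).trans (hR _ hf0 _ hf0)
  set V := totalVariation ℓ hbv with hV
  obtain ⟨θ, hθm, hθs, hθ⟩ := exists_inverse_clock (continuous_totalVariation ℓ hbv) V.mono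
    (totalVariation_zero ℓ hbv)
  have hθV : ∀ s t, s ≤ t → V (θ t) - V (θ s) ≤ t - s := fun s t hst => by
    have := hθ s t hst
    have h2 : (θ s : ℝ) ≤ θ t := NNReal.coe_le_coe.2 (hθm hst)
    linarith
  have hθt : ∀ s t, s ≤ t → (θ t : ℝ) - θ s ≤ t - s := fun s t hst => by
    have := hθ s t hst
    have h2 : V (θ s) ≤ V (θ t) := V.mono (hθm hst)
    linarith
  have hθ0 : θ 0 = 0 := by
    obtain ⟨u, hu⟩ := hθs 0
    exact le_antisymm ((hθm zero_le).trans_eq hu) zero_le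
  have hθ1 : LipschitzWith 1 θ := by
    refine LipschitzWith.of_dist_le_mul fun a b => ?_
    rw [NNReal.dist_eq, NNReal.dist_eq, NNReal.coe_one, one_mul]
    rcases le_total a b with hab | hab
    · rw [abs_sub_comm, abs_sub_comm (a : ℝ),
        abs_of_nonneg (sub_nonneg.2 (NNReal.coe_le_coe.2 hab)),
        abs_of_nonneg (sub_nonneg.2 (NNReal.coe_le_coe.2 (hθm hab)))]
      exact hθt a b hab
    · rw [abs_of_nonneg (sub_nonneg.2 (NNReal.coe_le_coe.2 hab)),
        abs_of_nonneg (sub_nonneg.2 (NNReal.coe_le_coe.2 (hθm hab)))]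
      exact hθt b a hab
  have hθle : ∀ t, θ t ≤ t := fun t => by
    have := hθt 0 t zero_le
    rw [hθ0] at this
    simpa using this
  have hℓθ : ∀ s t, s ≤ t → ‖ℓ (θ t) - ℓ (θ s)‖ ≤ t - s := fun s t hst =>
    (norm_sub_le_totalVariation_sub ℓ hbv (hθm hst)).trans (hθV s t hst)
  have hRθ : ReflectsLipschitz O ((fun t => (x t : EuclideanSpace ℝ (Fin d))) ∘ θ) (ℓ ∘ θ) := by
    intro T
    obtain ⟨L, hL⟩ := hf T
    -- The summands cover the speed of ℓ ∘ θ, the exterior balls, and the oscillation of x, which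
    -- moves at rate at most L + 1 under the clock.
    set C : ℝ≥0 := 1 + C₀.toNNReal + ((2 * R * C₀ + 1) * (L + 1)).toNNReal with hC
    have hC1 : (1 : ℝ) ≤ C := by
      rw [hC]; push_cast
      linarith [C₀.toNNReal.2, ((2 * R * C₀ + 1) * (L + 1)).toNNReal.2]
    have hC2 : C₀ ≤ C := by
      rw [hC]; push_cast
      linarith [Real.le_coe_toNNReal C₀, ((2 * R * C₀ + 1) * (L + 1)).toNNReal.2]
    have hC3 : (2 * R * C₀ + 1) * (L + 1) ≤ C := by
      rw [hC]; push_cast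
      linarith [C₀.toNNReal.2, Real.le_coe_toNNReal ((2 * R * C₀ + 1) * (L + 1))]
    refine ⟨C, lipschitzOnWith_Iic_of_le fun s t hst _ => ?_, fun s t hst htT z hz => ?_⟩
    · have h1 : (0 : ℝ) ≤ t - s := sub_nonneg.2 (NNReal.coe_le_coe.2 hst)
      exact (hℓθ s t hst).trans (le_mul_of_one_le_left h1 hC1)
    · have h1 : (0 : ℝ) ≤ t - s := sub_nonneg.2 (NNReal.coe_le_coe.2 hst)
      have hosc : ∀ u ∈ Icc (θ s) (θ t),
          ‖(x u : EuclideanSpace ℝ (Fin d)) - x (θ s)‖ ≤ (L + 1) * ((t : ℝ) - s) := fun u hu => by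
        have h2 : ‖f u - f (θ s)‖ ≤ L * ((t : ℝ) - s) := by
          have := hL.dist_le_mul u ((hu.2.trans (hθle t)).trans htT) (θ s)
            ((hθle s).trans (hst.trans htT))
          rw [dist_eq_norm, NNReal.dist_eq,
            abs_of_nonneg (sub_nonneg.2 (NNReal.coe_le_coe.2 hu.1))] at this
          refine this.trans (mul_le_mul_of_nonneg_left ?_ L.2)
          have h3 := hθt s t hst
          have h4 : (u : ℝ) ≤ θ t := NNReal.coe_le_coe.2 hu.2
          linarith
        have h5 : ‖ℓ u - ℓ (θ s)‖ ≤ (t : ℝ) - s := by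
          have h6 := norm_sub_le_totalVariation_sub ℓ hbv hu.1
          have h7 := hθV s t hst
          have h8 : V u ≤ V (θ t) := V.mono hu.2
          rw [← hV] at h6
          linarith
        rw [hxf, hxf, add_sub_add_comm]
        refine (norm_add_le _ _).trans ?_
        linarith
      have key := IsReflectionTerm.variational_inequality hC₀ hball hR hbv hnm hn hℓ
        (hθm hst) hosc hz
      refine key.trans ?_
      rw [add_assoc]
      refine add_le_add le_rfl ?_
      have h9 : 0 ≤ C₀ * ‖z - x (θ s)‖ ^ 2 + (2 * R * C₀ + 1) * ((L + 1) * ((t : ℝ) - s)) := by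
        positivity
      refine (mul_le_mul_of_nonneg_left (hθV s t hst) h9).trans ?_
      calc (C₀ * ‖z - x (θ s)‖ ^ 2 + (2 * R * C₀ + 1) * ((L + 1) * ((t : ℝ) - s))) * (t - s)
          = C₀ * (t - s) * ‖z - x (θ s)‖ ^ 2 +
            ((2 * R * C₀ + 1) * (L + 1)) * ((t : ℝ) - s) ^ 2 := by ring
        _ ≤ C * (t - s) * ‖z - x (θ s)‖ ^ 2 + C * ((t : ℝ) - s) ^ 2 := by gcongr
  -- Both paths, run by the clock of ℓ, reflect the same Lipschitz input f ∘ θ. Surjectivity of θ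
  -- then removes the clock.
  have heq := ReflectsLipschitz.unique h hO hb (f := f ∘ θ) (fun t => (x (θ t)).2)
    (fun t => hx' (θ t)) (fun t => hxf (θ t)) (fun t => hxf' (θ t))
    (by rw [hxf, hxf', hθ0, hℓ0, hℓ0']) hRθ (hR'.comp hθm hθ1 hθle)
    (hf.comp hθ1 hθle)
  have hxx : (fun t => (x t : EuclideanSpace ℝ (Fin d))) = x' := by
    ext1 t
    obtain ⟨u, rfl⟩ := hθs t
    exact congrFun heq u
  have hll : (ℓ : ℝ≥0 → EuclideanSpace ℝ (Fin d)) = ℓ' := by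
    ext1 t
    have h1 := congrFun hxx t
    rw [hxf, hxf'] at h1
    exact add_left_cancel h1
  rw [hxx, hll]
  exact hR'

/-- The Skorohod problem with Lipschitz input is uniquely solvable. -/
theorem IsAdmissible.existsUnique_isSkorohodSolution (h : IsAdmissible O) (hO : IsOpen O)
    (hb : Bornology.IsBounded O) {f : ℝ≥0 → EuclideanSpace ℝ (Fin d)} (hf : LipschitzOnBounded f)
    (hf0 : f 0 ∈ closure O) :
    ∃! p : C(ℝ≥0, closure O) × C(ℝ≥0, EuclideanSpace ℝ (Fin d)),
      IsSkorohodSolution O f p.1 p.2 := by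
  obtain ⟨x, ℓ, hx, hxf, hℓ0, hR⟩ := h.exists_reflectsLipschitz hO hb hf hf0
  have hcont : ∀ {g : ℝ≥0 → EuclideanSpace ℝ (Fin d)}, LipschitzOnBounded g → Continuous g := by
    refine fun {g} hg => continuous_iff_continuousAt.2 fun t => ?_
    obtain ⟨C, hC⟩ := hg (t + 1)
    exact hC.continuousOn.continuousAt (Iic_mem_nhds (lt_add_one t))
  have hxc : Continuous x := by
    have := hcont (hf.add hR.lipschitzOnBounded)
    rwa [← funext hxf] at this
  let X : C(ℝ≥0, closure O) := ⟨fun t => ⟨x t, hx t⟩, hxc.subtype_mk _⟩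
  let Λ : C(ℝ≥0, EuclideanSpace ℝ (Fin d)) := ⟨ℓ, hcont hR.lipschitzOnBounded⟩
  have hR1 : ReflectsLipschitz O (fun t => X t) Λ := hR
  refine ⟨(X, Λ), ⟨hxf, hR1.isReflectionTerm hO hℓ0⟩, ?_⟩
  rintro ⟨Y, Λ'⟩ hs
  have hs1 := hs.1
  have hΛ0 : Λ' 0 = 0 := hs.2.zero
  have hR2 := IsSkorohodSolution.reflectsLipschitz h hO hb hf hs
  have heq := ReflectsLipschitz.unique h hO hb (fun t => (Y t).2) hx hs1 hxf
    (by rw [hs1, hxf, hΛ0, hℓ0]) hR2 hR hf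
  have hYX : Y = X := by
    ext1 t
    exact Subtype.ext (congrFun heq t)
  refine Prod.ext hYX (ContinuousMap.ext fun t => ?_)
  have h1 := congrFun heq t
  rw [hs1, hxf] at h1
  exact add_left_cancel h1

end ReflectedODE

/-! ### Regularity of the driving path and of the driven input. -/

namespace ReflectedODE

/-- Induction over the breakpoints: an increment across one of them is split there, and the larger
of the two constants is kept. -/
theorem IsPiecewiseSmooth.lipschitzOnBounded {F : Type*} [NormedAddCommGroup F] [NormedSpace ℝ F]
    {w : C(ℝ≥0, F)} (hw : IsPiecewiseSmooth w) : LipschitzOnBounded w := by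
  obtain ⟨t, ht0, htm, htop, hw⟩ := hw
  have ht : ∀ n, 0 ≤ t n := fun n => ht0 ▸ htm.monotone (Nat.zero_le n)
  have key : ∀ n, ∃ C : ℝ≥0, ∀ a b : ℝ≥0, a ≤ b → (b : ℝ) ≤ t n →
      ‖w b - w a‖ ≤ C * ((b : ℝ) - a) := by
    intro n
    induction n with
    | zero =>
      refine ⟨0, fun a b hab hb => ?_⟩
      rw [ht0] at hb
      have h1 : b = 0 := NNReal.coe_injective (le_antisymm hb b.2)
      have h2 : a = 0 := le_antisymm (hab.trans h1.le) zero_le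
      rw [h1, h2]; simp
    | succ n ih =>
      obtain ⟨C, hC⟩ := ih
      obtain ⟨D, hD⟩ := (hw n).exists_lipschitzOnWith one_ne_zero (convex_Icc _ _) isCompact_Icc
      have hD' : ∀ a b : ℝ≥0, a ≤ b → t n ≤ a → (b : ℝ) ≤ t (n + 1) →
          ‖w b - w a‖ ≤ D * ((b : ℝ) - a) := fun a b hab ha hb => by
        have hab' : (a : ℝ) ≤ b := NNReal.coe_le_coe.2 hab
        have := hD.dist_le_mul b ⟨ha.trans hab', hb⟩ a ⟨ha, hab'.trans hb⟩
        simpa [dist_eq_norm, Real.norm_of_nonneg (sub_nonneg.2 hab')] using this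
      refine ⟨max C D, fun a b hab hb => ?_⟩
      have hab' : (a : ℝ) ≤ b := NNReal.coe_le_coe.2 hab
      have hCm : (C : ℝ) ≤ (max C D : ℝ≥0) := NNReal.coe_le_coe.2 (le_max_left _ _)
      have hDm : (D : ℝ) ≤ (max C D : ℝ≥0) := NNReal.coe_le_coe.2 (le_max_right _ _)
      rcases le_total (b : ℝ) (t n) with h1 | h1
      · exact (hC a b hab h1).trans (mul_le_mul_of_nonneg_right hCm (sub_nonneg.2 hab'))
      rcases le_total (t n) (a : ℝ) with h2 | h2
      · exact (hD' a b hab h2 hb).trans (mul_le_mul_of_nonneg_right hDm (sub_nonneg.2 hab'))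
      let m : ℝ≥0 := ⟨t n, ht n⟩
      have h3 := hC a m h2 le_rfl
      have h4 := hD' m b h1 le_rfl hb
      have h5 : (C : ℝ) * ((m : ℝ) - a) ≤ (max C D : ℝ≥0) * ((m : ℝ) - a) :=
        mul_le_mul_of_nonneg_right hCm (sub_nonneg.2 h2)
      have h6 : (D : ℝ) * ((b : ℝ) - m) ≤ (max C D : ℝ≥0) * ((b : ℝ) - m) :=
        mul_le_mul_of_nonneg_right hDm (sub_nonneg.2 h1)
      have h7 := norm_add_le (w b - w m) (w m - w a)
      rw [sub_add_sub_cancel] at h7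
      linarith
  intro T
  obtain ⟨n, hn⟩ := (htop.eventually_ge_atTop (T : ℝ)).exists
  obtain ⟨C, hC⟩ := key n
  exact ⟨C, lipschitzOnWith_Iic_of_le fun a b hab hb =>
    hC a b hab ((NNReal.coe_le_coe.2 hb).trans hn)⟩

section DrivenPath

variable {d r : ℕ} {O : Set (EuclideanSpace ℝ (Fin d))}
  {σ : closure O → EuclideanSpace ℝ (Fin r) →L[ℝ] EuclideanSpace ℝ (Fin d)}
  {w : C(ℝ≥0, EuclideanSpace ℝ (Fin r))}

theorem exists_norm_le_of_continuous (hb : Bornology.IsBounded O) (hσ : Continuous σ) :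
    ∃ S : ℝ≥0, ∀ x, ‖σ x‖ ≤ S := by
  have : CompactSpace (closure O) := isCompact_iff_compactSpace.1 hb.isCompact_closure
  obtain ⟨S, hS⟩ := isCompact_univ.exists_bound_of_continuousOn hσ.continuousOn
  exact ⟨S.toNNReal, fun x => (hS x (mem_univ _)).trans (Real.le_coe_toNNReal _)⟩

theorem norm_driver_le {S L T : ℝ≥0} (hS : ∀ x, ‖σ x‖ ≤ S) (hL : LipschitzOnWith L w (Iic (T + 1)))
    (y : C(ℝ≥0, closure O)) {s : ℝ} (hs : s ≤ T) :
    ‖σ (y s.toNNReal) (deriv (fun u : ℝ => w u.toNNReal) s)‖ ≤ (S * L : ℝ≥0) := by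
  have h1 := LipschitzOnWith.norm_deriv_toNNReal_le hL (s := s) (by push_cast; linarith)
  rw [NNReal.coe_mul]
  exact ((σ _).le_opNorm _).trans (mul_le_mul (hS _) h1 (norm_nonneg _) S.2)

theorem intervalIntegrable_driver (hb : Bornology.IsBounded O) (hσ : Continuous σ)
    (hw : LipschitzOnBounded w) (y : C(ℝ≥0, closure O)) (a b : ℝ) :
    IntervalIntegrable (fun s => σ (y s.toNNReal) (deriv (fun u : ℝ => w u.toNNReal) s))
      volume a b := by
  obtain ⟨S, hS⟩ := exists_norm_le_of_continuous hb hσ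
  obtain ⟨L, hL⟩ := hw ((max a b).toNNReal + 1)
  have hm : AEStronglyMeasurable
      (fun s => σ (y s.toNNReal) (deriv (fun u : ℝ => w u.toNNReal) s))
      (volume.restrict (uIoc a b)) := by
    have h1 : StronglyMeasurable fun s : ℝ => σ (y s.toNNReal) :=
      (hσ.comp (y.continuous.comp continuous_real_toNNReal)).stronglyMeasurable
    exact (isBoundedBilinearMap_apply.continuous.comp_stronglyMeasurable
      (h1.prodMk (stronglyMeasurable_deriv _))).aestronglyMeasurable
  refine (intervalIntegrable_const (c := ((S * L : ℝ≥0) : ℝ))).mono_fun hm ?_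
  refine (ae_restrict_iff' measurableSet_uIoc).2 (ae_of_all _ fun s hs => ?_)
  exact (norm_driver_le hS hL y (hs.2.trans (Real.le_coe_toNNReal _))).trans (le_abs_self _)

theorem lipschitzOnWith_drivenPath (hb : Bornology.IsBounded O) (hσ : Continuous σ)
    (hw : LipschitzOnBounded w) {S L T : ℝ≥0} (hS : ∀ x, ‖σ x‖ ≤ S)
    (hL : LipschitzOnWith L w (Iic (T + 1))) (x₀ : closure O) (y : C(ℝ≥0, closure O)) :
    LipschitzOnWith (S * L) (drivenPath σ w x₀ y) (Iic T) := by
  refine lipschitzOnWith_Iic_of_le fun s t hst htT => ?_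
  have hst' : (s : ℝ) ≤ t := NNReal.coe_le_coe.2 hst
  rw [drivenPath, drivenPath, add_sub_add_left_eq_sub, intervalIntegral.integral_interval_sub_left
    (intervalIntegrable_driver hb hσ hw y _ _) (intervalIntegrable_driver hb hσ hw y _ _)]
  have := intervalIntegral.norm_integral_le_of_norm_le_const (a := (s : ℝ)) (b := t)
    (C := (S * L : ℝ≥0)) (fun u hu => by
      rw [uIoc_of_le hst'] at hu
      exact norm_driver_le hS hL y (hu.2.trans (NNReal.coe_le_coe.2 htT)))
  rwa [abs_of_nonneg (sub_nonneg.2 hst')] at this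

theorem lipschitzOnBounded_drivenPath (hb : Bornology.IsBounded O) (hσ : Continuous σ)
    (hw : LipschitzOnBounded w) (x₀ : closure O) (y : C(ℝ≥0, closure O)) :
    LipschitzOnBounded (drivenPath σ w x₀ y) := fun T => by
  obtain ⟨S, hS⟩ := exists_norm_le_of_continuous hb hσ
  obtain ⟨L, hL⟩ := hw (T + 1)
  exact ⟨_, lipschitzOnWith_drivenPath hb hσ hw hS hL x₀ y⟩

theorem ae_deriv_drivenPath (hb : Bornology.IsBounded O) (hσ : Continuous σ)
    (hw : LipschitzOnBounded w) (x₀ : closure O) (y : C(ℝ≥0, closure O)) (T : ℝ≥0) :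
    ∀ᵐ s : ℝ, s ∈ Ioo (0 : ℝ) T → deriv (fun s : ℝ => drivenPath σ w x₀ y s.toNNReal) s =
      σ (y s.toNNReal) (deriv (fun u : ℝ => w u.toNNReal) s) := by
  filter_upwards [(intervalIntegrable_driver hb hσ hw y 0 T).ae_hasDerivAt_integral] with s hs hsT
  have h1 := (hs (by rw [uIcc_of_le T.coe_nonneg]; exact Ioo_subset_Icc_self hsT) 0 (by simp)
    ).const_add (x₀ : EuclideanSpace ℝ (Fin d))
  refine (h1.congr_of_eventuallyEq ?_).deriv
  filter_upwards [Ioi_mem_nhds hsT.1] with u hu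
  rw [drivenPath, Real.coe_toNNReal _ (le_of_lt hu)]

end DrivenPath

end ReflectedODE

/-! ### The Picard map, its contraction estimate and its fixed point. -/

namespace ReflectedODE

variable {d r : ℕ} {O : Set (EuclideanSpace ℝ (Fin d))}
  {σ : closure O → EuclideanSpace ℝ (Fin r) →L[ℝ] EuclideanSpace ℝ (Fin d)}
  {w : C(ℝ≥0, EuclideanSpace ℝ (Fin r))}

theorem IsAdmissible.existsUnique_drivenPath (h : IsAdmissible O) (hO : IsOpen O)
    (hb : Bornology.IsBounded O) (hσ : Continuous σ) (hw : LipschitzOnBounded w)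
    (x₀ : closure O) (y : C(ℝ≥0, closure O)) :
    ∃! p : C(ℝ≥0, closure O) × C(ℝ≥0, EuclideanSpace ℝ (Fin d)),
      IsSkorohodSolution O (drivenPath σ w x₀ y) p.1 p.2 :=
  h.existsUnique_isSkorohodSolution hO hb (lipschitzOnBounded_drivenPath hb hσ hw x₀ y)
    (drivenPath_zero_mem σ w x₀ y)

theorem IsAdmissible.exists_isSkorohodSolution_picardMap (h : IsAdmissible O) (hO : IsOpen O)
    (hb : Bornology.IsBounded O) (hσ : Continuous σ) (hw : LipschitzOnBounded w)
    (x₀ : closure O) (y : C(ℝ≥0, closure O)) :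
    ∃ ℓ, IsSkorohodSolution O (drivenPath σ w x₀ y) (picardMap σ w x₀ y) ℓ := by
  obtain ⟨p, hp, -⟩ := h.existsUnique_drivenPath hO hb hσ hw x₀ y
  have hex : ∃ x ℓ, IsSkorohodSolution O (drivenPath σ w x₀ y) x ℓ := ⟨p.1, p.2, hp⟩
  rw [picardMap, skorohodMap, dif_pos hex]
  exact hex.choose_spec

theorem IsAdmissible.picardMap_eq (h : IsAdmissible O) (hO : IsOpen O)
    (hb : Bornology.IsBounded O) (hσ : Continuous σ) (hw : LipschitzOnBounded w)
    {x₀ : closure O} {x y : C(ℝ≥0, closure O)} {ℓ : C(ℝ≥0, EuclideanSpace ℝ (Fin d))}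
    (hs : IsSkorohodSolution O (drivenPath σ w x₀ y) x ℓ) : picardMap σ w x₀ y = x := by
  obtain ⟨ℓ', hℓ'⟩ := h.exists_isSkorohodSolution_picardMap hO hb hσ hw x₀ y
  exact congrArg Prod.fst ((h.existsUnique_drivenPath hO hb hσ hw x₀ y).unique
    (y₁ := (picardMap σ w x₀ y, ℓ')) (y₂ := (x, ℓ)) hℓ' hs)

/-- The contraction estimate for the Picard map. -/
theorem IsAdmissible.exists_contraction (h : IsAdmissible O) (hO : IsOpen O)
    (hb : Bornology.IsBounded O) {K : ℝ≥0} (hσ : LipschitzWith K σ) (hw : LipschitzOnBounded w)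
    (T : ℝ≥0) : ∃ C : ℝ, ∀ (x₀ : closure O) (y y' : C(ℝ≥0, closure O)), ∀ t : ℝ≥0, t ≤ T →
      ‖(picardMap σ w x₀ y t : EuclideanSpace ℝ (Fin d)) - picardMap σ w x₀ y' t‖ ^ 2 ≤
        ∫ τ in (0 : ℝ)..t, Real.exp (C * (t - τ)) *
          ‖(y τ.toNNReal : EuclideanSpace ℝ (Fin d)) - y' τ.toNNReal‖ ^ 2 := by
  obtain ⟨S, hS⟩ := exists_norm_le_of_continuous hb hσ.continuous
  obtain ⟨L, hL⟩ := hw (T + 1)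
  -- The inputs have speed at most SL, and their velocities differ by at most KL|y - y'|; C depends
  -- on nothing else that varies with t, x₀, y or y'.
  obtain ⟨C, hC⟩ := h.exists_comparison hO hb (S * L) ((K * L) ^ 2)
  refine ⟨C, fun x₀ y y' t htT => ?_⟩
  obtain ⟨ℓ, hℓ⟩ := h.exists_isSkorohodSolution_picardMap hO hb hσ.continuous hw x₀ y
  obtain ⟨ℓ', hℓ'⟩ := h.exists_isSkorohodSolution_picardMap hO hb hσ.continuous hw x₀ y'
  have hf := lipschitzOnBounded_drivenPath hb hσ.continuous hw x₀ y
  have hf' := lipschitzOnBounded_drivenPath hb hσ.continuous hw x₀ y'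
  have hLt : LipschitzOnWith L w (Iic (t + 1)) :=
    hL.mono (Iic_subset_Iic.2 (add_le_add_left htT 1))
  have hsub : ∀ y : C(ℝ≥0, closure O), Continuous fun s : ℝ =>
      (y s.toNNReal : EuclideanSpace ℝ (Fin d)) := fun y =>
    continuous_subtype_val.comp (y.continuous.comp continuous_real_toNNReal)
  refine hC t (drivenPath σ w x₀ y) (drivenPath σ w x₀ y') (fun t => picardMap σ w x₀ y t)
    (fun t => picardMap σ w x₀ y' t) ℓ ℓ' (fun τ => ‖(y τ.toNNReal : EuclideanSpace ℝ (Fin d)) -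
      y' τ.toNNReal‖ ^ 2) (fun t => (picardMap σ w x₀ y t).2)
    (fun t => (picardMap σ w x₀ y' t).2) hℓ.1 hℓ'.1 ?_
    (IsSkorohodSolution.reflectsLipschitz h hO hb hf hℓ)
    (IsSkorohodSolution.reflectsLipschitz h hO hb hf' hℓ') hf hf'
    (lipschitzOnWith_drivenPath hb hσ.continuous hw hS hLt x₀ y)
    (lipschitzOnWith_drivenPath hb hσ.continuous hw hS hLt x₀ y')
    (fun s => sq_nonneg _) ((((hsub y).sub (hsub y')).norm.pow 2).intervalIntegrable _ _) ?_
  · rw [hℓ.1, hℓ'.1, hℓ.2.zero, hℓ'.2.zero]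
    simp [drivenPath]
  filter_upwards [ae_deriv_drivenPath hb hσ.continuous hw x₀ y t,
    ae_deriv_drivenPath hb hσ.continuous hw x₀ y' t] with s h1 h2 hs
  rw [h1 hs, h2 hs, ← sub_apply, NNReal.coe_pow, ← mul_pow]
  refine pow_le_pow_left₀ (norm_nonneg _) ?_ 2
  have hwd := LipschitzOnWith.norm_deriv_toNNReal_le hLt (s := s) (by push_cast; linarith [hs.2])
  have hσd := hσ.dist_le_mul (y s.toNNReal) (y' s.toNNReal)
  rw [dist_eq_norm, Subtype.dist_eq, dist_eq_norm] at hσd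
  calc _ ≤ ‖σ (y s.toNNReal) - σ (y' s.toNNReal)‖ * ‖deriv (fun u : ℝ => w u.toNNReal) s‖ :=
        ContinuousLinearMap.le_opNorm _ _
    _ ≤ K * ‖(y s.toNNReal : EuclideanSpace ℝ (Fin d)) - y' s.toNNReal‖ * L := by gcongr
    _ = _ := by push_cast; ring

/-- In a weighted norm the Picard map is a contraction of ratio `1 / 2` on a bounded time
interval. -/
theorem IsAdmissible.exists_weighted_contraction (h : IsAdmissible O) (hO : IsOpen O)
    (hb : Bornology.IsBounded O) {K : ℝ≥0} (hσ : LipschitzWith K σ) (hw : LipschitzOnBounded w)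
    (T : ℝ≥0) : ∃ A : ℝ, 0 < A ∧ ∀ (x₀ : closure O) (y y' : C(ℝ≥0, closure O)) (B : ℝ), 0 ≤ B →
      (∀ t ≤ T, dist (y t) (y' t) ^ 2 ≤ B * Real.exp (4 * A * t)) →
      ∀ t ≤ T, dist (picardMap σ w x₀ y t) (picardMap σ w x₀ y' t) ^ 2 ≤
        B / 4 * Real.exp (4 * A * t) := by
  obtain ⟨C, hC⟩ := h.exists_contraction hO hb hσ hw T
  -- A bounds the exponential kernel on [0, T]. Integrating A·B·exp(4Aτ) then gains the factor 1/4,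
  -- which is the ratio 1/2 after taking square roots.
  set A := Real.exp (|C| * T) with hA
  have hA0 : 0 < A := Real.exp_pos _
  refine ⟨A, hA0, fun x₀ y y' B hB hyy t htT => ?_⟩
  rw [Subtype.dist_eq, dist_eq_norm]
  refine (hC x₀ y y' t htT).trans ?_
  have hsub : ∀ y : C(ℝ≥0, closure O), Continuous fun s : ℝ =>
      (y s.toNNReal : EuclideanSpace ℝ (Fin d)) := fun y =>
    continuous_subtype_val.comp (y.continuous.comp continuous_real_toNNReal)
  have hle : ∀ τ ∈ Icc (0 : ℝ) t, Real.exp (C * (t - τ)) *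
      ‖(y τ.toNNReal : EuclideanSpace ℝ (Fin d)) - y' τ.toNNReal‖ ^ 2 ≤
      A * (B * Real.exp (4 * A * τ)) := fun τ hτ => by
    have htT' : (t : ℝ) ≤ T := NNReal.coe_le_coe.2 htT
    have h1 := hyy τ.toNNReal ((Real.toNNReal_le_iff_le_coe.2 hτ.2).trans htT)
    rw [Subtype.dist_eq, dist_eq_norm, Real.coe_toNNReal _ hτ.1] at h1
    have h2 : Real.exp (C * (t - τ)) ≤ A := by
      refine Real.exp_le_exp.2 ?_
      calc C * (t - τ) ≤ |C| * (t - τ) :=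
            mul_le_mul_of_nonneg_right (le_abs_self C) (sub_nonneg.2 hτ.2)
        _ ≤ |C| * T := mul_le_mul_of_nonneg_left (by linarith [hτ.1]) (abs_nonneg C)
    exact mul_le_mul h2 h1 (sq_nonneg _) hA0.le
  refine (intervalIntegral.integral_mono_on t.coe_nonneg (Continuous.intervalIntegrable
    ((by fun_prop : Continuous fun τ : ℝ => Real.exp (C * (t - τ))).mul
      (((hsub y).sub (hsub y')).norm.pow 2)) _ _)
    (Continuous.intervalIntegrable (by fun_prop) _ _) hle).trans ?_
  have hd : ∀ τ ∈ uIcc (0 : ℝ) t, HasDerivAt (fun τ => B / 4 * Real.exp (4 * A * τ))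
      (A * (B * Real.exp (4 * A * τ))) τ := fun τ _ => by
    have := (((hasDerivAt_id τ).const_mul (4 * A)).exp).const_mul (B / 4)
    refine this.congr_deriv ?_
    simp only [id]; ring
  rw [intervalIntegral.integral_eq_sub_of_hasDerivAt hd
    (Continuous.intervalIntegrable (by fun_prop) _ _)]
  have := Real.exp_pos (4 * A * 0)
  nlinarith

/-- The weight depends on the horizon T, so no single norm is used. The iterates converge
geometrically on every [0, T] with their own constants, and their pointwise limit does not depend on
T. The bounded diameter starts the iteration for any two paths, which also gives uniqueness. -/
theorem IsAdmissible.existsUnique_fixedPoint (h : IsAdmissible O) (hO : IsOpen O)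
    (hb : Bornology.IsBounded O) {K : ℝ≥0} (hσ : LipschitzWith K σ) (hw : LipschitzOnBounded w)
    (x₀ : closure O) : ∃! x : C(ℝ≥0, closure O), picardMap σ w x₀ x = x := by
  obtain ⟨R, hR⟩ : ∃ R : ℝ, ∀ x z : closure O, dist x z ≤ R := by
    obtain ⟨R, hR⟩ := Metric.isBounded_iff.1 hb.closure
    exact ⟨R, fun x z => hR x.2 z.2⟩
  have hcompl : CompleteSpace (closure O) := isClosed_closure.completeSpace_coe
  set F := picardMap σ w x₀
  -- a uniform bound for iterates that start at two arbitrary paths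
  have hbase : ∀ (y y' : C(ℝ≥0, closure O)) (t : ℝ≥0) (A : ℝ), 0 < A →
      dist (y t) (y' t) ^ 2 ≤ R ^ 2 * Real.exp (4 * A * t) := fun y y' t A hA => by
    have h1 := pow_le_pow_left₀ dist_nonneg (hR (y t) (y' t)) 2
    have h2 : 1 ≤ Real.exp (4 * A * t) := Real.one_le_exp (by positivity)
    nlinarith [sq_nonneg R]
  have hiter : ∀ T : ℝ≥0, ∃ A : ℝ, 0 < A ∧ ∀ (n : ℕ) (y y' : C(ℝ≥0, closure O)), ∀ t ≤ T,
      dist (F^[n] y t) (F^[n] y' t) ^ 2 ≤ R ^ 2 / 4 ^ n * Real.exp (4 * A * t) := fun T => by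
    obtain ⟨A, hA, hstep⟩ := h.exists_weighted_contraction hO hb hσ hw T
    refine ⟨A, hA, fun n y y' => ?_⟩
    induction n with
    | zero => exact fun t _ => by simpa using hbase y y' t A hA
    | succ n ih =>
      intro t ht
      rw [Function.iterate_succ_apply', Function.iterate_succ_apply', pow_succ (4 : ℝ), ← div_div]
      exact hstep x₀ _ _ _ (by positivity) ih t ht
  let x : ℕ → C(ℝ≥0, closure O) := fun n => F^[n] (ContinuousMap.const ℝ≥0 x₀)
  have hgeom : ∀ T : ℝ≥0, ∃ Q : ℝ, ∀ t ≤ T, ∀ n, dist (x n t) (x (n + 1) t) ≤ Q * (1 / 2) ^ n := by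
    intro T
    obtain ⟨A, hA, hit⟩ := hiter T
    refine ⟨|R| * Real.exp (2 * A * T), fun t ht n => ?_⟩
    have h1 := hit n (ContinuousMap.const ℝ≥0 x₀) (F (ContinuousMap.const ℝ≥0 x₀)) t ht
    refine abs_le_of_sq_le_sq' ?_ (by positivity) |>.2
    have e : F^[n] (F (ContinuousMap.const ℝ≥0 x₀)) = x (n + 1) :=
      (Function.iterate_succ_apply F n _).symm
    rw [e] at h1
    refine h1.trans ?_
    have h2 : Real.exp (4 * A * t) ≤ Real.exp (2 * A * T) ^ 2 := by
      rw [← Real.exp_nat_mul]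
      refine Real.exp_le_exp.2 ?_
      have : (t : ℝ) ≤ T := NNReal.coe_le_coe.2 ht
      push_cast
      nlinarith
    calc R ^ 2 / 4 ^ n * Real.exp (4 * A * t)
        ≤ R ^ 2 / 4 ^ n * Real.exp (2 * A * T) ^ 2 := by gcongr
      _ = _ := by
        rw [mul_pow, mul_pow, sq_abs, ← pow_mul, mul_comm n 2, pow_mul,
          show ((1 / 2 : ℝ) ^ 2) = 4⁻¹ by norm_num, inv_pow]
        ring
  have hlim : ∀ t, ∃ q, Tendsto (fun n => x n t) atTop (𝓝 q) := fun t => by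
    obtain ⟨Q, hQ⟩ := hgeom t
    exact cauchySeq_tendsto_of_complete
      (cauchySeq_of_le_geometric (1 / 2) Q (by norm_num) (hQ t le_rfl))
  choose q hq using hlim
  have hunif : ∀ T : ℝ≥0, ∃ Q : ℝ, ∀ t ≤ T, ∀ n, dist (x n t) (q t) ≤ Q * (1 / 2) ^ n := fun T => by
    obtain ⟨Q, hQ⟩ := hgeom T
    refine ⟨Q / (1 - 1 / 2), fun t ht n => ?_⟩
    refine (dist_le_of_le_geometric_of_tendsto (1 / 2) Q (by norm_num) (hQ t ht) (hq t) n).trans_eq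
      ?_
    ring
  have hpow : ∀ Q : ℝ, Tendsto (fun n : ℕ => Q * (1 / 2 : ℝ) ^ n) atTop (𝓝 0) := fun Q => by
    simpa using (tendsto_pow_atTop_nhds_zero_of_lt_one (r := (1 / 2 : ℝ)) (by norm_num)
      (by norm_num)).const_mul Q
  have hqc : Continuous q := by
    refine TendstoLocallyUniformly.continuous (F := fun n t => x n t) (p := atTop) ?_
      (Frequently.of_forall fun n => (x n).continuous)
    rw [Metric.tendstoLocallyUniformly_iff]
    intro ε hε t
    obtain ⟨Q, hQ⟩ := hunif (t + 1)
    refine ⟨Iic (t + 1), Iic_mem_nhds (lt_add_one t), ?_⟩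
    filter_upwards [(hpow Q).eventually_lt_const hε] with n hn s hs
    rw [dist_comm]
    exact (hQ s hs n).trans_lt hn
  refine ⟨⟨q, hqc⟩, ContinuousMap.ext fun t => ?_, fun y hy => ContinuousMap.ext fun t => ?_⟩
  · obtain ⟨A, hA, hstep⟩ := h.exists_weighted_contraction hO hb hσ hw t
    obtain ⟨Q, hQ⟩ := hunif t
    have hle : ∀ n, dist (x (n + 1) t) (F ⟨q, hqc⟩ t) ^ 2 ≤
        (Q * (1 / 2) ^ n) ^ 2 / 4 * Real.exp (4 * A * t) := fun n => by
      have e : x (n + 1) = F (x n) := Function.iterate_succ_apply' F n _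
      rw [e]
      refine hstep x₀ (x n) ⟨q, hqc⟩ _ (sq_nonneg _) (fun s hs => ?_) t le_rfl
      have h1 := pow_le_pow_left₀ dist_nonneg (hQ s hs n) 2
      have h2 : 1 ≤ Real.exp (4 * A * s) := Real.one_le_exp (by positivity)
      exact h1.trans (le_mul_of_one_le_right (sq_nonneg _) h2)
    have hl1 := (((tendsto_add_atTop_iff_nat 1).2 (hq t)).dist
      (tendsto_const_nhds (x := F ⟨q, hqc⟩ t))).pow 2
    have hl2 := (((hpow Q).pow 2).div_const 4).mul_const (Real.exp (4 * A * t))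
    have h3 := le_of_tendsto_of_tendsto' hl1 hl2 hle
    norm_num at h3
    exact h3.symm
  · obtain ⟨A, hA, hit⟩ := hiter t
    have hfix : ∀ n, F^[n] y = y := fun n => Function.iterate_fixed hy n
    have hle : ∀ n, dist (y t) (x n t) ^ 2 ≤ R ^ 2 / 4 ^ n * Real.exp (4 * A * t) := fun n => by
      have := hit n y (ContinuousMap.const ℝ≥0 x₀) t le_rfl
      rwa [hfix] at this
    have hl1 := ((tendsto_const_nhds (x := y t)).dist (hq t)).pow 2
    have hl2 : Tendsto (fun n : ℕ => R ^ 2 / 4 ^ n * Real.exp (4 * A * t)) atTop (𝓝 0) := by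
      have := ((tendsto_pow_atTop_nhds_zero_of_lt_one (r := (1 / 4 : ℝ)) (by norm_num)
        (by norm_num)).const_mul (R ^ 2)).mul_const (Real.exp (4 * A * t))
      simpa [div_eq_mul_inv] using this
    have h3 := le_of_tendsto_of_tendsto' hl1 hl2 hle
    exact dist_eq_zero.1 (pow_eq_zero_iff two_ne_zero |>.1 (le_antisymm h3 (sq_nonneg _)))

end ReflectedODE



theorem mainTheorem3 {d r : ℕ} (O : Set (EuclideanSpace ℝ (Fin d)))
    (hO_open : IsOpen O) (hO_conn : IsConnected O) (hO_bdd : Bornology.IsBounded O)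
    (hO_adm : ReflectedODE.IsAdmissible O)
    (σ : closure O → EuclideanSpace ℝ (Fin r) →L[ℝ] EuclideanSpace ℝ (Fin d))
    (hσ : ∃ K : ℝ≥0, LipschitzWith K σ)
    (w : C(ℝ≥0, EuclideanSpace ℝ (Fin r))) (hw : ReflectedODE.IsPiecewiseSmooth w) :
    -- the map `F_w` is well defined: each Skorohod problem that it involves is uniquely solvable
    (∀ (x₀ : closure O) (y : C(ℝ≥0, closure O)),
      ∃! p : C(ℝ≥0, closure O) × C(ℝ≥0, EuclideanSpace ℝ (Fin d)),
        ReflectedODE.IsSkorohodSolution O (ReflectedODE.drivenPath σ w x₀ y) p.1 p.2) ∧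
    -- the contraction estimate
    (∀ T : ℝ≥0, 0 < T → ∃ C : ℝ, ∀ (x₀ : closure O) (y y' : C(ℝ≥0, closure O)),
      ∀ t : ℝ≥0, t ≤ T →
        ‖(ReflectedODE.picardMap σ w x₀ y t : EuclideanSpace ℝ (Fin d)) -
            ReflectedODE.picardMap σ w x₀ y' t‖ ^ 2 ≤
          ∫ τ in (0 : ℝ)..t, Real.exp (C * (t - τ)) *
            ‖(y τ.toNNReal : EuclideanSpace ℝ (Fin d)) - y' τ.toNNReal‖ ^ 2) ∧
    -- the unique fixed point is the first component of the unique solution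
    (∀ x₀ : closure O,
      (∃! x : C(ℝ≥0, closure O), ReflectedODE.picardMap σ w x₀ x = x) ∧
      (∃! p : C(ℝ≥0, closure O) × C(ℝ≥0, EuclideanSpace ℝ (Fin d)),
        ReflectedODE.IsReflectedSolution σ w x₀ p.1 p.2) ∧
      ∀ (x : C(ℝ≥0, closure O)) (ℓ : C(ℝ≥0, EuclideanSpace ℝ (Fin d))),
        ReflectedODE.IsReflectedSolution σ w x₀ x ℓ → ReflectedODE.picardMap σ w x₀ x = x) := by

  obtain ⟨K, hK⟩ := hσ
  have hwL := hw.lipschitzOnBounded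
  have huniq := hO_adm.existsUnique_drivenPath hO_open hO_bdd hK.continuous hwL
  have hfix := hO_adm.existsUnique_fixedPoint hO_open hO_bdd hK hwL
  have hsol : ∀ (x₀ : closure O) (x : C(ℝ≥0, closure O))
      (ℓ : C(ℝ≥0, EuclideanSpace ℝ (Fin d))),
      ReflectedODE.IsReflectedSolution σ w x₀ x ℓ → ReflectedODE.picardMap σ w x₀ x = x :=
    fun x₀ x ℓ h => hO_adm.picardMap_eq hO_open hO_bdd hK.continuous hwL h
  refine ⟨huniq, fun T _ => hO_adm.exists_contraction hO_open hO_bdd hK hwL T, fun x₀ =>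
    ⟨hfix x₀, ?_, hsol x₀⟩⟩
  obtain ⟨x, hx, -⟩ := id (hfix x₀)
  obtain ⟨ℓ, hℓ⟩ := hO_adm.exists_isSkorohodSolution_picardMap hO_open hO_bdd hK.continuous hwL x₀ x
  rw [hx] at hℓ
  -- With y = x the Skorohod problem is, by definition, the reflected equation. Uniqueness of the
  -- fixed point determines x, and uniqueness for the input driven by x determines ℓ.
  refine ⟨(x, ℓ), hℓ, ?_⟩
  rintro ⟨x', ℓ'⟩ h'
  obtain rfl : x' = x := (hfix x₀).unique (hsol x₀ x' ℓ' h') hx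
  exact (huniq x₀ x').unique h' hℓ
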